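/- Let $N\ge 1$, let $F_1,\dots,F_R:2^{[N]}\to\mathbb R$ be submodular with $F_r(\emptyset)=0$ and $F_r\ge 0$, and let $B_r=\{y\in\mathbb R^N: y(S)\le F_r(S)\ \forall S\subseteq[N],\ y([N])=F_r([N])\}$ be the base polytope of $F_r$. Say that $i$ is incident to $F_r$, written $i\in S_r$, if $F_r(S)\ne F_r(S\cup\{i\})$ for some $S\subseteq [N]$, and assume that every $i\in[N]$ is incident to at least one $F_r$. Let $$D_{ii}=\sum_{r:\,i\in S_r}\max_{S\subseteq[N]}F_r(S)^2,\qquad \Psi_{ii}=|\{r: i\in S_r\}|$$ be (positive) diagonal matrices, let $\beta>0$, $W=\beta D$, $a\in\mathbb R^N$. For a positive diagonal matrix $V$ write $\|x\|_V^2=\sum_i V_{ii}x_i^2$. Let $C_r=\{(y_r,\phi_r):\phi_r\ge0,\ y_r\in\phi_rB_r\}$, $\mathcal C=\prod_r C_r$, and for $b\in\mathbb R^N$ let $\Pi_{C_r}(b;V)=\operatorname{argmin}_{(y_r,\phi_r)\in C_r}\|y_r-b\|_V^2+\phi_r^2$. Let $\Xi$ be the set of minimizers over $(y,\phi)\in\mathcal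 C$ of $$g(y,\phi)=\Big\|\sum_r y_r-2Wa\Big\|_{W^{-1}}^2+\sum_r\phi_r^2 ,$$ let $g^*$ be the minimum, and for a positive diagonal matrix $V$ put $$d_V((y,\phi),\Xi)^2=\min_{(y',\phi')\in\Xi}\ \sum_r\|y_r-y'_r\|_V^2+\|\phi-\phi'\|^2,\qquad d=d_{W^{-1}} .$$ *RCD.* Start at $(y^{(0)},\phi^{(0)})=(0,0)$. In iteration $k$ pick $r\in[R]$ uniformly at random, independently of the past, set $(y_r^{(k+1)},\phi_r^{(k+1)})=\Pi_{C_r}(2Wa-\sum_{r'\ne r}y_{r'}^{(k)};W^{-1})$ and keep all other blocks. *AP.* Start at $(0,0)$. In iteration $k$ let $\alpha^{(k+1)}=2W^{-1}\sum_r y_r^{(k)}-4a$; for every $r$ let $\lambda^{(k+1)}_{r,i}=y^{(k)}_{r,i}-\frac12(\Psi^{-1}W\alpha^{(k+1)})_i$ for $i\in S_r$ and $\lambda^{(k+1)}_{r,i}=0$ for $i\notin S_r$, and set $(y_r^{(k+1)},\phi_r^{(k+1)})=\Pi_{C_r}(\lambda_r^{(k+1)};\Psi W^{-1})$. Then $\Xi\neq\emptyset$,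 and there is an absolute constant $c>0$ (independent of $N,R,F,a,\beta,\varepsilon$) such that the following hold for $0<\varepsilon\le\frac12$. 1. If $\varepsilon\,[\,g(0,0)-g^*+d((0,0),\Xi)^2\,]\le 1$, put $$K=c\,N^2R\,\max\{1,9\beta^{-1}\}\ \max_{i,j\in[N]}\frac{D_{ii}}{D_{jj}}\ \log\frac1\varepsilon .$$ The expected number of iterations until RCD first satisfies $d((y^{(k)},\phi^{(k)}),\Xi)\le\varepsilon$ is at most $K$; moreover $\mathbb E\big[d((y^{(k)},\phi^{(k)}),\Xi)^2\big]\le\varepsilon^2$ for every $k\ge K$. 2. If $\varepsilon\, d_{\Psi W^{-1}}((0,0),\Xi)\le1$, then AP satisfies $d_{\Psi W^{-1}}((y^{(k)},\phi^{(k)}),\Xi)\le\varepsilon$ for every $$k\ \ge\ c\,N^2R\,\max\{1,9\beta^{-1}\}\ \max_{i,j\in[N]}\frac{\Psi_{jj}}{R}\,\frac{D_{ii}}{D_{jj}}\ \log\frac1\varepsilon .$$ -/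

import Mathlib

open MeasureTheory ProbabilityTheory
open scoped ENNReal

namespace QDSFM

noncomputable section

/-- Submodularity of a set function on the ground set `[N]`. -/
def IsSubmodular {N : ℕ} (F : Finset (Fin N) → ℝ) : Prop :=
  ∀ S T : Finset (Fin N), F (S ∪ T) + F (S ∩ T) ≤ F S + F T

/-- The element `i` is incident to `F`. We write `S_r` for `{i | IsIncident (F r) i}`. -/
def IsIncident {N : ℕ} (F : Finset (Fin N) → ℝ) (i : Fin N) : Prop :=
  ∃ S : Finset (Fin N), F S ≠ F (insert i S)

/-- The base polytope `B` of `F`. -/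
def basePolytope {N : ℕ} (F : Finset (Fin N) → ℝ) : Set (Fin N → ℝ) :=
  {y | (∀ S : Finset (Fin N), ∑ i ∈ S, y i ≤ F S) ∧ ∑ i, y i = F Finset.univ}

/-- The squared norm `‖x‖_V ^ 2 = ∑ i, V_ii x_i ^ 2` of the diagonal matrix with diagonal `V`.
Diagonal matrices are represented by their diagonals throughout. -/
def normSq {N : ℕ} (V x : Fin N → ℝ) : ℝ := ∑ i, V i * x i ^ 2

/-- The cone `C = {(y, φ) | φ ≥ 0, y ∈ φ B}` of `F`. -/
def cone {N : ℕ} (F : Finset (Fin N) → ℝ) : Set ((Fin N → ℝ) × ℝ) :=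
  {z | 0 ≤ z.2 ∧ ∃ b ∈ basePolytope F, z.1 = z.2 • b}

/-- `z` is a point of the cone `C` that minimizes `‖y - b‖_V ^ 2 + φ ^ 2` over `(y, φ) ∈ C`. -/
def IsConicProj {N : ℕ} (F : Finset (Fin N) → ℝ) (V b : Fin N → ℝ)
    (z : (Fin N → ℝ) × ℝ) : Prop :=
  z ∈ cone F ∧ ∀ z' ∈ cone F, normSq V (z.1 - b) + z.2 ^ 2 ≤ normSq V (z'.1 - b) + z'.2 ^ 2

/-- The conic projection `Π_C(b; V)`. For a normalized submodular `F` and a positive `V` the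
minimizer exists and is unique. -/
def conicProj {N : ℕ} (F : Finset (Fin N) → ℝ) (V b : Fin N → ℝ) : (Fin N → ℝ) × ℝ :=
  Classical.epsilon (IsConicProj F V b)

/-- Pairs `(y, φ)` with `y = (y_1, …, y_R)`, `y_r ∈ ℝ^N`, and `φ ∈ ℝ^R`. -/
abbrev DualVar (N R : ℕ) : Type := (Fin R → Fin N → ℝ) × (Fin R → ℝ)

/-- The product of the cones `C_r`. -/
def prodCone {N R : ℕ} (F : Fin R → Finset (Fin N) → ℝ) : Set (DualVar N R) :=
  {z | ∀ r, (z.1 r, z.2 r) ∈ cone (F r)}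

/-- The dual objective
`g(y, φ) = ‖∑ r, y_r - 2 W a‖_{W⁻¹} ^ 2 + ∑ r, φ_r ^ 2`. -/
def dualObj {N R : ℕ} (W a : Fin N → ℝ) (z : DualVar N R) : ℝ :=
  normSq W⁻¹ (∑ r, z.1 r - 2 • (W * a)) + ∑ r, z.2 r ^ 2

/-- The set `Ξ` of solutions of the dual problem: the minimizers of `g` over the product cone. -/
def solutionSet {N R : ℕ} (F : Fin R → Finset (Fin N) → ℝ) (W a : Fin N → ℝ) :
    Set (DualVar N R) :=
  {z | z ∈ prodCone F ∧ ∀ z' ∈ prodCone F, dualObj W a z ≤ dualObj W a z'}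

/-- The optimal value `g^*` of the dual problem. -/
def optValue {N R : ℕ} (F : Fin R → Finset (Fin N) → ℝ) (W a : Fin N → ℝ) : ℝ :=
  sInf (dualObj W a '' prodCone F)

/-- The distance `√(min_{(y', φ') ∈ X} ‖y - y'‖_{I(V)} ^ 2 + ‖φ - φ'‖ ^ 2)` of `z = (y, φ)`
to `X`. -/
def wDist {N R : ℕ} (V : Fin N → ℝ) (z : DualVar N R) (X : Set (DualVar N R)) : ℝ :=
  √(sInf ((fun z' : DualVar N R =>
    ∑ r, normSq V (z.1 r - z'.1 r) + ∑ r, (z.2 r - z'.2 r) ^ 2) '' X))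

open Classical in
/-- `D_ii = ∑_{r : i ∈ S_r} max_S F_r(S) ^ 2`. -/
def degD {N R : ℕ} (F : Fin R → Finset (Fin N) → ℝ) (i : Fin N) : ℝ :=
  ∑ r with IsIncident (F r) i, ⨆ S : Finset (Fin N), F r S ^ 2

open Classical in
/-- `Ψ_ii = |{r | i ∈ S_r}|`. -/
def degPsi {N R : ℕ} (F : Fin R → Finset (Fin N) → ℝ) (i : Fin N) : ℝ :=
  ((Finset.univ.filter fun r => IsIncident (F r) i).card : ℝ)

/-- One iteration of the random coordinate descent method, with the coordinate `r` picked. -/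
def rcdStep {N R : ℕ} (F : Fin R → Finset (Fin N) → ℝ) (W a : Fin N → ℝ) (r : Fin R)
    (z : DualVar N R) : DualVar N R :=
  let p := conicProj (F r) W⁻¹ (2 • (W * a) - ∑ r' ∈ Finset.univ.erase r, z.1 r')
  (Function.update z.1 r p.1, Function.update z.2 r p.2)

/-- The iterates `(y^(k), φ^(k))` of the random coordinate descent method, started at `0`, when
the coordinate `idx k` is picked in iteration `k`. -/
def rcd {N R : ℕ} (F : Fin R → Finset (Fin N) → ℝ) (W a : Fin N → ℝ) (idx : ℕ → Fin R) :
    ℕ → DualVar N R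
  | 0 => 0
  | k + 1 => rcdStep F W a (idx k) (rcd F W a idx k)

open Classical in
/-- One iteration of the alternating projection method. -/
def apStep {N R : ℕ} (F : Fin R → Finset (Fin N) → ℝ) (W a : Fin N → ℝ)
    (z : DualVar N R) : DualVar N R :=
  let α : Fin N → ℝ := 2 • (W⁻¹ * ∑ r, z.1 r) - 4 • a
  let lam : Fin R → Fin N → ℝ := fun r i =>
    if IsIncident (F r) i then z.1 r i - (1 / 2) * ((degPsi F i)⁻¹ * W i * α i) else 0
  let p : Fin R → (Fin N → ℝ) × ℝ := fun r => conicProj (F r) (degPsi F * W⁻¹) (lam r)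
  (fun r => (p r).1, fun r => (p r).2)

/-- The iterates `(y^(k), φ^(k))` of the alternating projection method, started at `0`. -/
def ap {N R : ℕ} (F : Fin R → Finset (Fin N) → ℝ) (W a : Fin N → ℝ) : ℕ → DualVar N R
  | 0 => 0
  | k + 1 => apStep F W a (ap F W a k)

/-- `N² R max{1, 9 β⁻¹} max_{i,j} D_ii / D_jj`. -/
def rcdBound {N R : ℕ} (F : Fin R → Finset (Fin N) → ℝ) (β : ℝ) : ℝ :=
  (N : ℝ) ^ 2 * R * max 1 (9 * β⁻¹) * ⨆ p : Fin N × Fin N, degD F p.1 / degD F p.2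

/-- `N² R max{1, 9 β⁻¹} max_{i,j} (Ψ_jj / R) (D_ii / D_jj)`. -/
def apBound {N R : ℕ} (F : Fin R → Finset (Fin N) → ℝ) (β : ℝ) : ℝ :=
  (N : ℝ) ^ 2 * R * max 1 (9 * β⁻¹) *
    ⨆ p : Fin N × Fin N, degPsi F p.2 / R * (degD F p.1 / degD F p.2)

/-- The first `k` with `wDist V (z k) X ≤ ε`, and `∞` if there is none. -/
def hitTime {N R : ℕ} (V : Fin N → ℝ) (X : Set (DualVar N R)) (ε : ℝ)
    (z : ℕ → DualVar N R) : ℝ≥0∞ :=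
  ⨅ (k : ℕ) (_ : wDist V (z k) X ≤ ε), (k : ℝ≥0∞)

end

end QDSFM

/-!
The dual objective `g` depends on `(y, φ)` only through the block sum `∑ r, y r` and `φ`, and is
the sum of two squared norms of these. Hence `g z - g^*` is at least the squared discrepancy
`quadGap` between these quantities at `z` and at any minimizer (`IsProblem.quadGap_le`), and any
point of the product of the cones that has the same block sum and `φ` as a minimizer is one itself.

Both rates follow from an error bound: the squared distance of `z` to the solutions is at most a
constant multiple of `quadGap` (`IsProblem.exists_sqDist_le`). To reach a solution from
`z = (y, φ)`, each block is first scaled so that its `φ` becomes optimal; this is cheap since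
the entries of a base of `F r` are at most `max F r`, and its `ℓ¹` norm at most `2 max F r`. It
remains to correct the block sum inside a product of base polytopes
(`exists_mem_basePolytope_sum_eq`). The Euclidean projection to the points with the right block
sum does this: optimality forbids cyclic exchanges between the blocks, and tight sets,
which form a lattice, show that the mass passing through a coordinate is at most the `ℓ¹` norm of
the required correction.

For random coordinate descent, the exact minimization over a block and the obtuse angle property of
the projection show that the average over the blocks of the potential
`g z - g^* + d (z, Ξ) ^ 2` drops by at least `(g z - g^* + quadGap) / R`, so that the error
bound makes its expectation decay geometrically; the expected hitting time is then bounded by a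
geometric series (`hitTime_le`). For alternating projections, the squared distance to the
intermediate point `apTarget` majorizes the first part of `g`, and the same computation shows that
a step decreases the squared distance to the solutions by at least `quadGap`.
-/


namespace QDSFM


/-! ### Base polytopes -/

section BasePolytope

variable {N : ℕ} {F : Finset (Fin N) → ℝ}

/-- The point built by the greedy algorithm along the natural order of `Fin N` lies in the base
polytope. -/
theorem basePolytope_nonempty (hF : IsSubmodular F) (h0 : F ∅ = 0) :
    (basePolytope F).Nonempty := by
  let P : ℕ → Finset (Fin N) := fun k => Finset.univ.filter fun i => i.val < k
  refine ⟨fun i => F (P (i + 1)) - F (P i), ?_, ?_⟩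
  · intro S
    induction S using Finset.induction_on_max with
    | empty => simp [h0]
    | insert a s hs ih =>
      have ha : a ∉ s := fun h => lt_irrefl _ (hs a h)
      have hu : insert a s ∪ P a = P (a + 1) := by
        ext i
        simp only [P, Finset.mem_union, Finset.mem_insert, Finset.mem_filter, Finset.mem_univ,
          true_and, Order.lt_add_one_iff]
        constructor
        · rintro ((rfl | h) | h)
          · exact le_rfl
          · exact (hs i h).le
          · exact h.le
        · intro h
          rcases h.lt_or_eq with h | h
          · exact Or.inr h
          · exact Or.inl (Or.inl (Fin.ext h))
      have hi : insert a s ∩ P a = s := by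
        ext i
        simp only [P, Finset.mem_inter, Finset.mem_insert, Finset.mem_filter, Finset.mem_univ,
          true_and]
        constructor
        · rintro ⟨rfl | h, h'⟩
          · exact absurd h' (lt_irrefl _)
          · exact h
        · exact fun h => ⟨Or.inr h, hs i h⟩
      have := hF (insert a s) (P a)
      rw [hu, hi] at this
      rw [Finset.sum_insert ha]
      linarith
  · rw [Fin.sum_univ_eq_sum_range (fun k => F (P (k + 1)) - F (P k)) N,
      Finset.sum_range_sub (fun k => F (P k))]
    simp [P, h0]

theorem IsSubmodular.smul (hF : IsSubmodular F) {c : ℝ} (hc : 0 ≤ c) :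
    IsSubmodular (c • F) := fun S T => by
  simpa [mul_add] using mul_le_mul_of_nonneg_left (hF S T) hc

theorem smul_mem_basePolytope {b : Fin N → ℝ} (hb : b ∈ basePolytope F) {c : ℝ} (hc : 0 ≤ c) :
    c • b ∈ basePolytope (c • F) := by
  refine ⟨fun S => ?_, ?_⟩
  · simpa [← Finset.mul_sum] using mul_le_mul_of_nonneg_left (hb.1 S) hc
  · simp [← Finset.mul_sum, hb.2]

/-- The cone of `F` in a form that does not single out `φ = 0`. -/
theorem mem_cone_iff (hF : IsSubmodular F) (h0 : F ∅ = 0) (z : (Fin N → ℝ) × ℝ) :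
    z ∈ cone F ↔ 0 ≤ z.2 ∧ z.1 ∈ basePolytope (z.2 • F) := by
  constructor
  · rintro ⟨hz, b, hb, h⟩
    exact ⟨hz, h ▸ smul_mem_basePolytope hb hz⟩
  · rintro ⟨hz, h⟩
    refine ⟨hz, ?_⟩
    rcases hz.eq_or_lt with h' | h'
    · obtain ⟨b, hb⟩ := basePolytope_nonempty hF h0
      refine ⟨b, hb, ?_⟩
      rw [← h'] at h ⊢
      have h1 : ∀ i ∈ Finset.univ, z.1 i ≤ 0 := fun i _ => by simpa using h.1 {i}
      have h2 : ∑ i, z.1 i = 0 := by simpa using h.2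
      ext i
      simpa using (Finset.sum_eq_zero_iff_of_nonpos h1).1 h2 i (Finset.mem_univ i)
    · refine ⟨z.2⁻¹ • z.1, ?_, by simp [smul_smul, h'.ne']⟩
      simpa [smul_smul, h'.ne'] using smul_mem_basePolytope h (inv_nonneg.2 hz)

theorem convex_basePolytope : Convex ℝ (basePolytope F) := by
  intro x hx y hy s t hs ht hst
  have hsum : ∀ S : Finset (Fin N),
      ∑ i ∈ S, (s • x + t • y) i = s * ∑ i ∈ S, x i + t * ∑ i ∈ S, y i := fun S => by
    simp [Finset.sum_add_distrib, Finset.mul_sum]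
  refine ⟨fun S => ?_, ?_⟩
  · rw [hsum]
    calc _ ≤ s * F S + t * F S :=
          add_le_add (mul_le_mul_of_nonneg_left (hx.1 S) hs)
            (mul_le_mul_of_nonneg_left (hy.1 S) ht)
      _ = F S := by rw [← add_mul, hst, one_mul]
  · rw [hsum, hx.2, hy.2, ← add_mul, hst, one_mul]

theorem isClosed_basePolytope : IsClosed (basePolytope F) := by
  have h : basePolytope F = (⋂ S : Finset (Fin N), {y | ∑ i ∈ S, y i ≤ F S}) ∩
      {y | ∑ i, y i = F Finset.univ} := by
    ext y; simp [basePolytope]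
  rw [h]
  exact (isClosed_iInter fun S => isClosed_le (by fun_prop) (by fun_prop)).inter
    (isClosed_eq (by fun_prop) (by fun_prop))

theorem apply_le_of_mem_basePolytope {b : Fin N → ℝ} (hb : b ∈ basePolytope F) (i : Fin N) :
    b i ≤ F {i} := by simpa using hb.1 {i}

theorem le_apply_of_mem_basePolytope {b : Fin N → ℝ} (hb : b ∈ basePolytope F) (i : Fin N) :
    F Finset.univ - F (Finset.univ.erase i) ≤ b i := by
  have h1 := hb.1 (Finset.univ.erase i)
  have h2 := Finset.add_sum_erase Finset.univ b (Finset.mem_univ i)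
  have h3 := hb.2
  linarith

theorem isCompact_basePolytope : IsCompact (basePolytope F) := by
  refine (isCompact_Icc (a := fun i => F Finset.univ - F (Finset.univ.erase i))
    (b := fun i => F {i})).of_isClosed_subset isClosed_basePolytope fun y hy => ?_
  exact ⟨fun i => le_apply_of_mem_basePolytope hy i, fun i => apply_le_of_mem_basePolytope hy i⟩

theorem abs_apply_le_of_mem_basePolytope {b : Fin N → ℝ} (hb : b ∈ basePolytope F)
    (hpos : ∀ S, 0 ≤ F S) {M : ℝ} (hM : ∀ S, F S ≤ M) (i : Fin N) : |b i| ≤ M := by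
  have h1 := apply_le_of_mem_basePolytope hb i
  have h2 := le_apply_of_mem_basePolytope hb i
  have h3 := hM {i}
  have h4 := hM (Finset.univ.erase i)
  have h5 := hpos Finset.univ
  exact abs_le.2 ⟨by linarith, by linarith⟩

/-- The positive part of a base sums to at most `M`, and so does its negative part because
`F [N] ≥ 0`. -/
theorem sum_abs_le_of_mem_basePolytope {b : Fin N → ℝ} (hb : b ∈ basePolytope F)
    (hpos : ∀ S, 0 ≤ F S) {M : ℝ} (hM : ∀ S, F S ≤ M) : ∑ i, |b i| ≤ 2 * M := by
  have h : ∑ i, |b i| = 2 * ∑ i ∈ Finset.univ.filter (fun i => 0 ≤ b i), b i - ∑ i, b i := by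
    rw [Finset.sum_filter, Finset.mul_sum, ← Finset.sum_sub_distrib]
    refine Finset.sum_congr rfl fun i _ => ?_
    split_ifs with h
    · rw [abs_of_nonneg h]; ring
    · rw [abs_of_neg (not_le.1 h)]; ring
  have h1 := hb.1 (Finset.univ.filter (fun i => 0 ≤ b i))
  have h2 := hM (Finset.univ.filter (fun i => 0 ≤ b i))
  have h3 := hpos Finset.univ
  rw [h, hb.2]
  linarith

theorem apply_eq_zero_of_not_isIncident {b : Fin N → ℝ} (hb : b ∈ basePolytope F)
    (h0 : F ∅ = 0) {i : Fin N} (hi : ¬ IsIncident F i) : b i = 0 := by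
  simp only [IsIncident, not_exists, not_not] at hi
  have h1 := apply_le_of_mem_basePolytope hb i
  have h2 := le_apply_of_mem_basePolytope hb i
  have h3 := hi ∅
  have h4 := hi (Finset.univ.erase i)
  rw [Finset.insert_erase (Finset.mem_univ i)] at h4
  simp only [insert_empty_eq] at h3
  linarith

/-! ### Tight sets and exchanges -/

/-- If no positive amount can be moved from coordinate `j` to coordinate `k`, then some tight set
separates `k` from `j`. -/
theorem exists_tight_of_forall_exchange_not_mem {y : Fin N → ℝ} (hy : y ∈ basePolytope F)
    {k j : Fin N}
    (h : ∀ t : ℝ, 0 < t → y + t • (Pi.single k 1 - Pi.single j 1) ∉ basePolytope F) :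
    ∃ T : Finset (Fin N), k ∈ T ∧ j ∉ T ∧ ∑ i ∈ T, y i = F T := by
  classical
  by_contra! hcon
  obtain ⟨T₀, hT₀⟩ := Finite.exists_min
    (fun T : Finset (Fin N) => if k ∈ T ∧ j ∉ T then F T - ∑ i ∈ T, y i else 1)
  set t : ℝ := if k ∈ T₀ ∧ j ∉ T₀ then F T₀ - ∑ i ∈ T₀, y i else 1 with ht
  have htpos : 0 < t := by
    rw [ht]
    split_ifs with hc
    · exact sub_pos.2 (lt_of_le_of_ne (hy.1 T₀) (hcon T₀ hc.1 hc.2))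
    · exact one_pos
  have hsum : ∀ T : Finset (Fin N),
      ∑ i ∈ T, (y + t • (Pi.single k 1 - Pi.single j 1 : Fin N → ℝ)) i =
        ∑ i ∈ T, y i + t * ((if k ∈ T then 1 else 0) - if j ∈ T then 1 else 0) := fun T => by
    simp only [Pi.add_apply, Pi.smul_apply, Pi.sub_apply, smul_eq_mul, Finset.sum_add_distrib,
      ← Finset.mul_sum, Finset.sum_sub_distrib, Finset.sum_pi_single']
  refine h t htpos ⟨fun T => ?_, ?_⟩
  · rw [hsum]
    have h1 := hy.1 T
    have h2 := hT₀ T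
    by_cases hk : k ∈ T <;> by_cases hj : j ∈ T <;> simp [hk, hj] at h2 ⊢ <;> linarith
  · rw [hsum]
    simp [hy.2]

theorem tight_union_inter (hF : IsSubmodular F) {y : Fin N → ℝ} (hy : y ∈ basePolytope F)
    {S T : Finset (Fin N)} (hS : ∑ i ∈ S, y i = F S) (hT : ∑ i ∈ T, y i = F T) :
    ∑ i ∈ S ∪ T, y i = F (S ∪ T) ∧ ∑ i ∈ S ∩ T, y i = F (S ∩ T) := by
  have h1 := hy.1 (S ∪ T)
  have h2 := hy.1 (S ∩ T)
  have h3 := hF S T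
  have h4 : ∑ i ∈ S ∪ T, y i + ∑ i ∈ S ∩ T, y i = ∑ i ∈ S, y i + ∑ i ∈ T, y i :=
    Finset.sum_union_inter
  constructor <;> linarith

/-- Tight sets form a lattice, so pairwise separation by tight sets yields separation of sets. -/
theorem exists_tight_separating (hF : IsSubmodular F) (h0 : F ∅ = 0) {y : Fin N → ℝ}
    (hy : y ∈ basePolytope F) (A B : Finset (Fin N))
    (h : ∀ k ∈ A, ∀ j ∈ B, ∃ T : Finset (Fin N), k ∈ T ∧ j ∉ T ∧ ∑ i ∈ T, y i = F T) :
    ∃ T : Finset (Fin N), (∀ k ∈ A, k ∈ T) ∧ (∀ j ∈ B, j ∉ T) ∧ ∑ i ∈ T, y i = F T := by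
  have hB : ∀ k ∈ A, ∃ T : Finset (Fin N), k ∈ T ∧ (∀ j ∈ B, j ∉ T) ∧ ∑ i ∈ T, y i = F T := by
    intro k hk
    replace h := h k hk
    clear hk
    induction B using Finset.induction_on with
    | empty => exact ⟨Finset.univ, Finset.mem_univ k, by simp, hy.2⟩
    | insert b B _ ih =>
      obtain ⟨T₁, h1, h2, h3⟩ := ih fun j hj => h j (Finset.mem_insert_of_mem hj)
      obtain ⟨T₂, g1, g2, g3⟩ := h b (Finset.mem_insert_self b B)
      refine ⟨T₁ ∩ T₂, Finset.mem_inter.2 ⟨h1, g1⟩, fun j hj hjT => ?_,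
        (tight_union_inter hF hy h3 g3).2⟩
      rcases Finset.mem_insert.1 hj with rfl | hj
      · exact g2 (Finset.mem_inter.1 hjT).2
      · exact h2 j hj (Finset.mem_inter.1 hjT).1
  clear h
  induction A using Finset.induction_on with
  | empty => exact ⟨∅, by simp, by simp, by simp [h0]⟩
  | insert a A _ ih =>
    obtain ⟨T₁, h1, h2, h3⟩ := ih fun k hk => hB k (Finset.mem_insert_of_mem hk)
    obtain ⟨T₂, g1, g2, g3⟩ := hB a (Finset.mem_insert_self a A)
    refine ⟨T₁ ∪ T₂, fun k hk => ?_, fun j hj hjT => ?_, (tight_union_inter hF hy h3 g3).1⟩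
    · rcases Finset.mem_insert.1 hk with rfl | hk
      · exact Finset.mem_union_right _ g1
      · exact Finset.mem_union_left _ (h1 k hk)
    · rcases Finset.mem_union.1 hjT with h | h
      · exact h2 j hj h
      · exact g2 j hj h

/-- If no exchange towards `x` moves mass of `y` into `U` from outside `U`, or from `i ∈ U` to
another element of `U`, then the mass of `y - x` on `U` is at least the positive part of `y - x`
at `i`. -/
theorem posPart_le_sum_of_forall_exchange_not_mem (hF : IsSubmodular F) (h0 : F ∅ = 0)
    {x y : Fin N → ℝ} (hx : x ∈ basePolytope F) (hy : y ∈ basePolytope F) (U : Finset (Fin N))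
    {i : Fin N} (hi : i ∈ U)
    (h : ∀ k ∈ U, y k - x k < 0 → ∀ j, 0 < y j - x j → (j ∉ U ∨ j = i) → ∀ t : ℝ, 0 < t →
      y + t • (Pi.single k 1 - Pi.single j 1) ∉ basePolytope F) :
    max (y i - x i) 0 ≤ ∑ k ∈ U, (y k - x k) := by
  classical
  obtain ⟨T, hA, hB, hT⟩ := exists_tight_separating hF h0 hy
    (U.filter fun k => y k - x k < 0)
    (Finset.univ.filter fun j => 0 < y j - x j ∧ (j ∉ U ∨ j = i)) (fun k hk j hj => by
      simp only [Finset.mem_filter, Finset.mem_univ, true_and] at hk hj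
      exact exists_tight_of_forall_exchange_not_mem hy (h k hk.1 hk.2 j hj.1 hj.2))
  simp only [Finset.mem_filter, Finset.mem_univ, true_and] at hA hB
  have hTpos : 0 ≤ ∑ k ∈ T, (y k - x k) := by
    rw [Finset.sum_sub_distrib, hT]
    linarith [hx.1 T]
  have key : ∑ k ∈ T, (y k - x k) + max (y i - x i) 0 ≤ ∑ k ∈ U, (y k - x k) := by
    have e1 : ∀ S : Finset (Fin N), ∑ k ∈ S, (y k - x k) =
        ∑ k, if k ∈ S then y k - x k else 0 := fun S => by simp
    have e2 : max (y i - x i) 0 = ∑ k, if k = i then max (y i - x i) 0 else 0 := by simp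
    rw [e1 T, e1 U, e2, ← Finset.sum_add_distrib]
    refine Finset.sum_le_sum fun k _ => ?_
    have hAk := hA k
    have hBk := hB k
    rcases eq_or_ne k i with rfl | hki
    · by_cases hkT : k ∈ T
      · have : y k - x k ≤ 0 := not_lt.1 fun hc => hBk ⟨hc, Or.inr rfl⟩ hkT
        simp [hkT, hi, this]
      · have : 0 ≤ y k - x k := not_lt.1 fun hc => hkT (hAk ⟨hi, hc⟩)
        simp [hkT, hi]
        linarith
    · by_cases hkT : k ∈ T <;> by_cases hkU : k ∈ U
      · simp [hkT, hkU, hki]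
      · have : y k - x k ≤ 0 := not_lt.1 fun hc => hBk ⟨hc, Or.inl hkU⟩ hkT
        simp only [hkT, hkU, hki, if_true, if_false]
        linarith
      · have : 0 ≤ y k - x k := not_lt.1 fun hc => hkT (hAk ⟨hkU, hc⟩)
        simp only [hkT, hkU, hki, if_true, if_false]
        linarith
      · simp [hkT, hkU, hki]
  linarith

end BasePolytope

/-! ### Redistribution between base polytopes -/

/-- A quadratic without constant term that is nonnegative on `(0, δ]` has a nonnegative slope
at `0`. -/
theorem nonneg_of_forall_quadratic_nonneg {L Q δ : ℝ} (hδ : 0 < δ)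
    (h : ∀ t : ℝ, 0 < t → t ≤ δ → 0 ≤ t * L + t ^ 2 * Q) : 0 ≤ L := by
  by_contra! hL
  set t := min δ (-L / (2 * (|Q| + 1))) with ht
  have hQ : 0 < |Q| + 1 := by positivity
  have ht0 : 0 < t := lt_min hδ (div_pos (by linarith) (by positivity))
  have h1 := h t ht0 (min_le_left _ _)
  have h2 : t * (2 * (|Q| + 1)) ≤ -L := (le_div_iff₀ (by positivity)).1 (min_le_right _ _)
  have h3 : 0 ≤ L + t * Q := by
    have : t * L + t ^ 2 * Q = t * (L + t * Q) := by ring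
    exact nonneg_of_mul_nonneg_right (this ▸ h1) ht0
  have h4 : t * Q ≤ t * |Q| := mul_le_mul_of_nonneg_left (le_abs_self Q) ht0.le
  have h5 : 0 ≤ t * |Q| := by positivity
  linarith

/-- Given `y` and `w` in a product of base polytopes, `y` can be changed inside the product so
that its blocks sum to `∑ r, w r`, with total change at each coordinate bounded by the `ℓ¹`
distance of the two sums. The point is the Euclidean projection `y'` of `y` to the
points of the product with the prescribed sum. Say that `k` reaches `j` if some feasible direction
at `y'` decreases the distance to `y` and has block sum `e_k - e_j`. This relation is transitive,
and irreflexive by minimality of `y'`; nothing flows into the set of points reached from `i`. -/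
theorem exists_mem_basePolytope_sum_eq {N R : ℕ} {G : Fin R → Finset (Fin N) → ℝ}
    (hG : ∀ r, IsSubmodular (G r)) (h0 : ∀ r, G r ∅ = 0) {y w : Fin R → Fin N → ℝ}
    (hy : ∀ r, y r ∈ basePolytope (G r)) (hw : ∀ r, w r ∈ basePolytope (G r)) :
    ∃ y' : Fin R → Fin N → ℝ, (∀ r, y' r ∈ basePolytope (G r)) ∧ ∑ r, y' r = ∑ r, w r ∧
      ∀ i, ∑ r, |y' r i - y r i| ≤ 3 * ∑ k, |(∑ r, w r) k - (∑ r, y r) k| := by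
  classical
  obtain ⟨y', ⟨hy', hsum⟩, hmin⟩ : ∃ y' ∈ {x : Fin R → Fin N → ℝ |
      (∀ r, x r ∈ basePolytope (G r)) ∧ ∑ r, x r = ∑ r, w r},
      ∀ x ∈ {x : Fin R → Fin N → ℝ | (∀ r, x r ∈ basePolytope (G r)) ∧ ∑ r, x r = ∑ r, w r},
        ∑ r, ∑ i, (y' r i - y r i) ^ 2 ≤ ∑ r, ∑ i, (x r i - y r i) ^ 2 := by
    have hK : IsCompact {x : Fin R → Fin N → ℝ |
        (∀ r, x r ∈ basePolytope (G r)) ∧ ∑ r, x r = ∑ r, w r} := by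
      have h1 : IsCompact {x : Fin R → Fin N → ℝ | ∀ r, x r ∈ basePolytope (G r)} := by
        simpa [Set.pi] using isCompact_univ_pi fun r => isCompact_basePolytope (F := G r)
      exact h1.inter_right (isClosed_eq (by fun_prop) (by fun_prop))
    obtain ⟨x, hx, hm⟩ := hK.exists_isMinOn ⟨w, hw, rfl⟩
      (f := fun x => ∑ r, ∑ i, (x r i - y r i) ^ 2) (by fun_prop)
    exact ⟨x, hx, fun x' hx' => hm hx'⟩
  refine ⟨y', hy', hsum, fun i => ?_⟩
  let Q : Fin N → Fin N → Prop := fun k j => ∃ (d : Fin R → Fin N → ℝ) (t : ℝ), 0 < t ∧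
    (∀ r, y' r + t • d r ∈ basePolytope (G r)) ∧
    ∑ r, d r = Pi.single k 1 - Pi.single j 1 ∧ ∑ r, ∑ i, d r i * (y' r i - y r i) < 0
  have hQtrans : ∀ k l j, Q k l → Q l j → Q k j := by
    rintro k l j ⟨d, t, ht, hd, hds, hdn⟩ ⟨e, s, hs, he, hes, hen⟩
    refine ⟨d + e, t * s / (t + s), by positivity, fun r => ?_, ?_, ?_⟩
    · have h := convex_basePolytope (hd r) (he r) (a := s / (t + s)) (b := t / (t + s))
        (by positivity) (by positivity) (by field_simp; ring)
      convert h using 1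
      ext i
      simp only [Pi.add_apply, Pi.smul_apply, smul_eq_mul]
      field_simp
      ring
    · simp only [Pi.add_apply, Finset.sum_add_distrib, hds, hes]
      abel
    · simp only [Pi.add_apply, add_mul, Finset.sum_add_distrib]
      linarith
  have hQirr : ∀ k, ¬ Q k k := by
    rintro k ⟨d, t, ht, hd, hds, hdn⟩
    have := nonneg_of_forall_quadratic_nonneg (L := 2 * ∑ r, ∑ i, d r i * (y' r i - y r i))
      (Q := ∑ r, ∑ i, d r i ^ 2) ht fun s hs hst => by
        have hmem : ∀ r, (y' + s • d) r ∈ basePolytope (G r) := fun r => by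
          have h := convex_basePolytope (hy' r) (hd r) (a := 1 - s / t) (b := s / t)
            (sub_nonneg.2 ((div_le_one ht).2 hst)) (by positivity) (by ring)
          convert h using 1
          ext i
          simp only [Pi.add_apply, Pi.smul_apply, smul_eq_mul]
          field_simp
          ring
        have hs' : ∑ r, (y' + s • d) r = ∑ r, w r := by
          simp [Finset.sum_add_distrib, ← Finset.smul_sum, hds, hsum]
        have h := hmin _ ⟨hmem, hs'⟩
        have e : ∑ r, ∑ i, ((y' + s • d) r i - y r i) ^ 2 =
            ∑ r, ∑ i, (y' r i - y r i) ^ 2 + (s * (2 * ∑ r, ∑ i, d r i * (y' r i - y r i)) +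
              s ^ 2 * ∑ r, ∑ i, d r i ^ 2) := by
          simp only [Finset.mul_sum, ← Finset.sum_add_distrib]
          refine Finset.sum_congr rfl fun r _ => Finset.sum_congr rfl fun i _ => ?_
          simp only [Pi.add_apply, Pi.smul_apply, smul_eq_mul]
          ring
        linarith
    linarith
  have hQedge : ∀ r k j, y' r k - y r k < 0 → 0 < y' r j - y r j → ∀ t : ℝ, 0 < t →
      y' r + t • (Pi.single k 1 - Pi.single j 1) ∈ basePolytope (G r) → Q k j := by
    intro r k j hk hj t ht hmem
    refine ⟨Pi.single r (Pi.single k 1 - Pi.single j 1), t, ht, fun r' => ?_, ?_, ?_⟩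
    · rcases eq_or_ne r' r with rfl | hr
      · simpa using hmem
      · simpa [hr] using hy' r'
    · simp
    · rw [Finset.sum_eq_single r (fun r' _ hr => by simp [hr]) (by simp)]
      simp only [Pi.single_eq_same, Pi.sub_apply, sub_mul, Finset.sum_sub_distrib,
        Pi.single_apply, ite_mul, one_mul, zero_mul, Finset.sum_ite_eq', Finset.mem_univ, if_true]
      linarith
  let U : Finset (Fin N) := Finset.univ.filter fun k => k = i ∨ Q i k
  have hpos : ∀ r, max (y' r i - y r i) 0 ≤ ∑ k ∈ U, (y' r k - y r k) := by
    intro r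
    refine posPart_le_sum_of_forall_exchange_not_mem (hG r) (h0 r) (hy r) (hy' r) U (by simp [U])
      fun k hk hk0 j hj0 hj t ht hmem => ?_
    have hkj := hQedge r k j hk0 hj0 t ht hmem
    have hij : Q i j := by
      rcases (Finset.mem_filter.1 hk).2 with rfl | hik
      · exact hkj
      · exact hQtrans _ _ _ hik hkj
    rcases hj with hj | rfl
    · exact hj (by simp [U, hij])
    · exact hQirr _ hij
  have hdiff : ∀ k, ∑ r, (y' r k - y r k) = (∑ r, w r) k - (∑ r, y r) k := fun k => by
    rw [← hsum, Finset.sum_sub_distrib, Finset.sum_apply, Finset.sum_apply]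
  have h1 : ∑ r, max (y' r i - y r i) 0 ≤ ∑ k, |(∑ r, w r) k - (∑ r, y r) k| :=
    calc _ ≤ ∑ r, ∑ k ∈ U, (y' r k - y r k) := Finset.sum_le_sum fun r _ => hpos r
      _ = ∑ k ∈ U, ((∑ r, w r) k - (∑ r, y r) k) := by
          rw [Finset.sum_comm]
          exact Finset.sum_congr rfl fun k _ => hdiff k
      _ ≤ ∑ k ∈ U, |(∑ r, w r) k - (∑ r, y r) k| :=
          Finset.sum_le_sum fun k _ => le_abs_self _
      _ ≤ _ := Finset.sum_le_sum_of_subset_of_nonneg (Finset.subset_univ U)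
          fun k _ _ => abs_nonneg _
  have h2 : |(∑ r, w r) i - (∑ r, y r) i| ≤ ∑ k, |(∑ r, w r) k - (∑ r, y r) k| :=
    Finset.single_le_sum (f := fun k => |(∑ r, w r) k - (∑ r, y r) k|)
      (fun k _ => abs_nonneg _) (Finset.mem_univ i)
  have h3 : ∑ r, |y' r i - y r i| =
      2 * ∑ r, max (y' r i - y r i) 0 - ((∑ r, w r) i - (∑ r, y r) i) := by
    rw [← hdiff i, Finset.mul_sum, ← Finset.sum_sub_distrib]
    refine Finset.sum_congr rfl fun r _ => ?_
    rcases le_total 0 (y' r i - y r i) with h | h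
    · rw [abs_of_nonneg h, max_eq_left h]; ring
    · rw [abs_of_nonpos h, max_eq_right h]; ring
  have h4 := neg_abs_le ((∑ r, w r) i - (∑ r, y r) i)
  linarith


/-! ### Degrees -/

/-- The largest absolute value `max_S |F S|` of a set function. -/
noncomputable def maxAbs {N : ℕ} (F : Finset (Fin N) → ℝ) : ℝ := √(⨆ S : Finset (Fin N), F S ^ 2)

theorem sq_le_iSup_sq {N : ℕ} (F : Finset (Fin N) → ℝ) (S : Finset (Fin N)) :
    F S ^ 2 ≤ ⨆ S : Finset (Fin N), F S ^ 2 :=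
  le_ciSup (f := fun S => F S ^ 2) (Set.finite_range _).bddAbove S

theorem maxAbs_sq {N : ℕ} (F : Finset (Fin N) → ℝ) :
    maxAbs F ^ 2 = ⨆ S : Finset (Fin N), F S ^ 2 :=
  Real.sq_sqrt ((sq_nonneg _).trans (sq_le_iSup_sq F ∅))

theorem le_maxAbs {N : ℕ} (F : Finset (Fin N) → ℝ) (S : Finset (Fin N)) : F S ≤ maxAbs F :=
  Real.le_sqrt_of_sq_le (sq_le_iSup_sq F S)

theorem IsIncident.maxAbs_pos {N : ℕ} {F : Finset (Fin N) → ℝ} {i : Fin N}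
    (h : IsIncident F i) : 0 < maxAbs F ^ 2 := by
  obtain ⟨S, hS⟩ := h
  rw [maxAbs_sq]
  by_contra! hc
  have h0 : ∀ T, F T = 0 := fun T =>
    pow_eq_zero_iff (two_ne_zero) |>.1 (le_antisymm ((sq_le_iSup_sq F T).trans hc) (sq_nonneg _))
  exact hS (by rw [h0, h0])

theorem maxAbs_eq_zero_of_forall_not_isIncident {N : ℕ} {F : Finset (Fin N) → ℝ} (h0 : F ∅ = 0)
    (h : ∀ i, ¬ IsIncident F i) : maxAbs F = 0 := by
  have hF : ∀ S, F S = 0 := fun S => by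
    induction S using Finset.induction_on with
    | empty => exact h0
    | insert a S _ ih =>
      rw [← ih]
      by_contra hne
      exact h a ⟨S, fun e => hne e.symm⟩
  simp [maxAbs, hF]

/-- The assumptions on the data of the quadratic problem: normalized nonnegative submodular
functions, every element incident to one of them, and `W = β D` with `β > 0`. -/
structure IsProblem {N R : ℕ} (F : Fin R → Finset (Fin N) → ℝ) (W : Fin N → ℝ) (β : ℝ) :
    Prop where
  submodular : ∀ r, IsSubmodular (F r)
  map_empty : ∀ r, F r ∅ = 0
  nonneg : ∀ r S, 0 ≤ F r S
  incident : ∀ i, ∃ r, IsIncident (F r) i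
  beta_pos : 0 < β
  weight_eq : ∀ i, W i = β * degD F i

section Degrees

variable {N R : ℕ} {F : Fin R → Finset (Fin N) → ℝ} {W : Fin N → ℝ} {β : ℝ}

open Classical in
theorem degD_eq (F : Fin R → Finset (Fin N) → ℝ) (i : Fin N) :
    degD F i = ∑ r, if IsIncident (F r) i then maxAbs (F r) ^ 2 else 0 := by
  simp only [maxAbs_sq]
  rw [← Finset.sum_filter]
  rfl

theorem maxAbs_sq_le_degD {r : Fin R} {i : Fin N} (h : IsIncident (F r) i) :
    maxAbs (F r) ^ 2 ≤ degD F i := by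
  classical
  rw [degD_eq]
  have := Finset.single_le_sum (f := fun r => if IsIncident (F r) i then maxAbs (F r) ^ 2 else 0)
    (fun r _ => by positivity) (Finset.mem_univ r)
  simpa [h] using this

theorem IsProblem.degD_pos (h : IsProblem F W β) (i : Fin N) : 0 < degD F i := by
  obtain ⟨r, hr⟩ := h.incident i
  exact hr.maxAbs_pos.trans_le (maxAbs_sq_le_degD hr)

theorem IsProblem.weight_pos (h : IsProblem F W β) (i : Fin N) : 0 < W i := by
  rw [h.weight_eq]
  exact mul_pos h.beta_pos (h.degD_pos i)

theorem IsProblem.one_le_degPsi (h : IsProblem F W β) (i : Fin N) : 1 ≤ degPsi F i := by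
  classical
  obtain ⟨r, hr⟩ := h.incident i
  have : 0 < (Finset.univ.filter fun r => IsIncident (F r) i).card :=
    Finset.card_pos.2 ⟨r, by simpa using hr⟩
  unfold degPsi
  exact_mod_cast this

theorem IsProblem.sum_maxAbs_sq_le (h : IsProblem F W β) :
    ∑ r, maxAbs (F r) ^ 2 ≤ ∑ i, degD F i := by
  classical
  simp only [degD_eq]
  rw [Finset.sum_comm]
  refine Finset.sum_le_sum fun r _ => ?_
  by_cases hr : ∃ i, IsIncident (F r) i
  · obtain ⟨i, hi⟩ := hr
    have := Finset.single_le_sum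
      (f := fun i => if IsIncident (F r) i then maxAbs (F r) ^ 2 else 0)
      (fun i _ => by positivity) (Finset.mem_univ i)
    simpa [hi] using this
  · rw [maxAbs_eq_zero_of_forall_not_isIncident (h.map_empty r) (not_exists.1 hr)]
    simp

/-! ### The error bound -/

/-- The squared distance of two dual variables that underlies `wDist V`. -/
noncomputable def sqDist (V : Fin N → ℝ) (z z' : DualVar N R) : ℝ :=
  ∑ r, normSq V (z.1 r - z'.1 r) + ∑ r, (z.2 r - z'.2 r) ^ 2

/-- The quadratic part of the dual objective, evaluated at the difference of two points. -/
noncomputable def quadGap (W : Fin N → ℝ) (z z' : DualVar N R) : ℝ :=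
  normSq W⁻¹ (∑ r, z.1 r - ∑ r, z'.1 r) + ∑ r, (z.2 r - z'.2 r) ^ 2

theorem normSq_nonneg {V : Fin N → ℝ} (hV : ∀ i, 0 ≤ V i) (x : Fin N → ℝ) : 0 ≤ normSq V x :=
  Finset.sum_nonneg fun i _ => mul_nonneg (hV i) (sq_nonneg _)

theorem normSq_add_le {V : Fin N → ℝ} (hV : ∀ i, 0 ≤ V i) (x y : Fin N → ℝ) :
    normSq V (x + y) ≤ 2 * normSq V x + 2 * normSq V y := by
  unfold normSq
  rw [Finset.mul_sum, Finset.mul_sum, ← Finset.sum_add_distrib]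
  refine Finset.sum_le_sum fun i _ => ?_
  have := mul_nonneg (hV i) (sq_nonneg (x i - y i))
  simp only [Pi.add_apply]
  nlinarith

theorem sq_sum_abs_le {W : Fin N → ℝ} (hW : ∀ i, 0 < W i) (x : Fin N → ℝ) :
    (∑ i, |x i|) ^ 2 ≤ (∑ i, W i) * normSq W⁻¹ x := by
  refine Finset.sum_sq_le_sum_mul_sum_of_sq_le_mul _ (fun i _ => (hW i).le)
    (fun i _ => mul_nonneg (inv_nonneg.2 (hW i).le) (sq_nonneg _)) fun i _ => le_of_eq ?_
  have := (hW i).ne'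
  simp only [Pi.inv_apply, sq_abs]
  field_simp

/-- Error bound: a point of the product of the cones can be moved to one with prescribed
`φ`-part and block sum, at a squared cost controlled by the discrepancy of these quantities alone.
The `φ`-part is adjusted by scaling each block; then mass is redistributed between the blocks. -/
theorem IsProblem.exists_sqDist_le (h : IsProblem F W β) {θ : Fin N → ℝ} (hθ : ∀ i, 0 ≤ θ i)
    {ρ : ℝ} (hρ1 : 1 ≤ ρ) (hρ : ∀ i j, θ j * degD F i ≤ ρ * degD F j) (hN : 0 < N)
    {z z' : DualVar N R} (hz : z ∈ prodCone F) (hz' : z' ∈ prodCone F) :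
    ∃ y : Fin R → Fin N → ℝ, (y, z'.2) ∈ prodCone F ∧ ∑ r, y r = ∑ r, z'.1 r ∧
      sqDist (θ * W⁻¹) z (y, z'.2) ≤ 36 * (N ^ 2 * max 1 (9 * β⁻¹) * ρ) * quadGap W z z' := by
  classical
  have hβ := h.beta_pos
  have hD := h.degD_pos
  have hW := h.weight_pos
  have hV : ∀ i, 0 ≤ (θ * W⁻¹) i := fun i => mul_nonneg (hθ i) (inv_nonneg.2 (hW i).le)
  choose hz0 b hb hzb using hz
  simp only at hz0 hzb
  have hz'0 : ∀ r, 0 ≤ z'.2 r := fun r => (hz' r).1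
  obtain ⟨y, hy, hysum, hyle⟩ := exists_mem_basePolytope_sum_eq
    (G := fun r => z'.2 r • F r) (y := fun r => z'.2 r • b r) (w := z'.1)
    (fun r => (h.submodular r).smul (hz'0 r)) (fun r => by simp [h.map_empty])
    (fun r => smul_mem_basePolytope (hb r) (hz'0 r))
    (fun r => ((mem_cone_iff (h.submodular r) (h.map_empty r) _).1 (hz' r)).2)
  refine ⟨y, fun r => (mem_cone_iff (h.submodular r) (h.map_empty r) _).2 ⟨hz'0 r, hy r⟩,
    hysum, ?_⟩
  set X : ℝ := ∑ r, (z.2 r - z'.2 r) ^ 2 with hX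
  set Y : ℝ := normSq W⁻¹ (∑ r, z.1 r - ∑ r, z'.1 r) with hY
  set T : ℝ := ∑ k, |(∑ r, z'.1 r) k - (∑ r, z'.2 r • b r) k| with hT
  set SD : ℝ := ∑ i, degD F i with hSD
  have hX0 : 0 ≤ X := Finset.sum_nonneg fun r _ => sq_nonneg _
  have hY0 : 0 ≤ Y := normSq_nonneg (fun i => inv_nonneg.2 (hW i).le) _
  have hSD0 : 0 ≤ SD := Finset.sum_nonneg fun i _ => (hD i).le
  have hSW : ∑ i, W i = β * SD := by
    rw [hSD, Finset.mul_sum]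
    exact Finset.sum_congr rfl fun i _ => h.weight_eq i
  have hTle : T ^ 2 ≤ 2 * (β * SD) * Y + 8 * SD * X := by
    set T₁ : ℝ := ∑ k, |(∑ r, z.1 r - ∑ r, z'.1 r) k| with hT₁
    set T₂ : ℝ := ∑ r, |z.2 r - z'.2 r| * (2 * maxAbs (F r)) with hT₂
    have h1 : T ≤ T₁ + T₂ := by
      have e : ∀ k, |(∑ r, z'.1 r) k - (∑ r, z'.2 r • b r) k| ≤
          |(∑ r, z.1 r - ∑ r, z'.1 r) k| + ∑ r, |z.2 r - z'.2 r| * |b r k| := by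
        intro k
        have e1 : (∑ r, z'.1 r) k - (∑ r, z'.2 r • b r) k =
            -(∑ r, z.1 r - ∑ r, z'.1 r) k + ∑ r, (z.2 r - z'.2 r) * b r k := by
          simp only [Pi.sub_apply, Finset.sum_apply, Pi.smul_apply, smul_eq_mul, sub_mul,
            Finset.sum_sub_distrib]
          have : ∀ r, z.1 r k = z.2 r * b r k := fun r => by rw [hzb r]; rfl
          simp only [this]
          ring
        rw [e1]
        refine (abs_add_le _ _).trans ?_
        rw [abs_neg]
        gcongr
        refine (Finset.abs_sum_le_sum_abs _ _).trans (le_of_eq ?_)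
        simp only [abs_mul]
      calc T ≤ ∑ k, (|(∑ r, z.1 r - ∑ r, z'.1 r) k| + ∑ r, |z.2 r - z'.2 r| * |b r k|) :=
            Finset.sum_le_sum fun k _ => e k
        _ = T₁ + ∑ r, |z.2 r - z'.2 r| * ∑ k, |b r k| := by
            rw [Finset.sum_add_distrib, Finset.sum_comm (s := Finset.univ (α := Fin N))]
            simp only [Finset.mul_sum, hT₁]
        _ ≤ T₁ + T₂ := by
            refine add_le_add le_rfl (Finset.sum_le_sum fun r _ =>
              mul_le_mul_of_nonneg_left ?_ (abs_nonneg _))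
            exact sum_abs_le_of_mem_basePolytope (hb r) (h.nonneg r) (le_maxAbs (F r))
    have h2 : T₁ ^ 2 ≤ (β * SD) * Y := hSW ▸ sq_sum_abs_le hW _
    have h3 : T₂ ^ 2 ≤ X * (4 * SD) := by
      refine (Finset.sum_mul_sq_le_sq_mul_sq _ _ _).trans ?_
      simp only [sq_abs, mul_pow, ← Finset.mul_sum]
      refine mul_le_mul_of_nonneg_left ?_ hX0
      have := h.sum_maxAbs_sq_le
      linarith
    have h4 : 0 ≤ T := Finset.sum_nonneg fun k _ => abs_nonneg _
    nlinarith [sq_nonneg (T₁ - T₂)]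
  have hρ0 : 0 ≤ ρ := by linarith
  have hSV : (∑ i, (θ * W⁻¹) i) * SD ≤ N ^ 2 * ρ * β⁻¹ := by
    rw [hSD, Finset.sum_mul_sum]
    calc _ ≤ ∑ _i : Fin N, ∑ _j : Fin N, ρ * β⁻¹ := by
          refine Finset.sum_le_sum fun j _ => Finset.sum_le_sum fun i _ => ?_
          simp only [Pi.mul_apply, Pi.inv_apply, h.weight_eq, mul_inv]
          have h1 := mul_le_mul_of_nonneg_right (hρ i j)
            (mul_nonneg (inv_nonneg.2 hβ.le) (inv_nonneg.2 (hD j).le))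
          have h2 : ρ * degD F j * (β⁻¹ * (degD F j)⁻¹) = ρ * β⁻¹ := by
            have := (hD j).ne'
            field_simp
          linarith
      _ = _ := by simp; ring
  have hscale : ∑ r, normSq (θ * W⁻¹) (z.1 r - z'.2 r • b r) ≤ X * (N * ρ * β⁻¹) := by
    rw [hX, Finset.sum_mul]
    refine Finset.sum_le_sum fun r _ => ?_
    have e : normSq (θ * W⁻¹) (z.1 r - z'.2 r • b r) =
        (z.2 r - z'.2 r) ^ 2 * ∑ i, (θ * W⁻¹) i * b r i ^ 2 := by
      unfold normSq
      rw [Finset.mul_sum]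
      refine Finset.sum_congr rfl fun i _ => ?_
      rw [hzb r]
      simp only [Pi.sub_apply, Pi.smul_apply, smul_eq_mul]
      ring
    rw [e]
    refine mul_le_mul_of_nonneg_left ?_ (sq_nonneg _)
    calc _ ≤ ∑ _i : Fin N, ρ * β⁻¹ := by
          refine Finset.sum_le_sum fun i _ => ?_
          by_cases hi : IsIncident (F r) i
          · have h1 : b r i ^ 2 ≤ degD F i :=
              (sq_le_sq' (abs_le.1 (abs_apply_le_of_mem_basePolytope (hb r) (h.nonneg r)
                (le_maxAbs (F r)) i)).1 (abs_le.1 (abs_apply_le_of_mem_basePolytope (hb r)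
                (h.nonneg r) (le_maxAbs (F r)) i)).2).trans (maxAbs_sq_le_degD hi)
            have h2 : θ i ≤ ρ := le_of_mul_le_mul_right (hρ i i) (hD i)
            calc _ ≤ (θ * W⁻¹) i * degD F i := mul_le_mul_of_nonneg_left h1 (hV i)
              _ = θ i * β⁻¹ := by
                simp only [Pi.mul_apply, Pi.inv_apply, h.weight_eq]
                have := (hD i).ne'
                field_simp
              _ ≤ ρ * β⁻¹ := by gcongr
          · rw [apply_eq_zero_of_not_isIncident (hb r) (h.map_empty r) hi]
            simp only [ne_eq, OfNat.ofNat_ne_zero, not_false_eq_true, zero_pow, mul_zero]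
            positivity
      _ = N * ρ * β⁻¹ := by simp; ring
  have hmove : ∑ r, normSq (θ * W⁻¹) (z'.2 r • b r - y r) ≤ (∑ i, (θ * W⁻¹) i) * (3 * T) ^ 2 := by
    unfold normSq
    rw [Finset.sum_comm, Finset.sum_mul]
    refine Finset.sum_le_sum fun i _ => ?_
    rw [← Finset.mul_sum]
    refine mul_le_mul_of_nonneg_left ?_ (hV i)
    calc ∑ r, (z'.2 r • b r - y r) i ^ 2 = ∑ r, |y r i - (z'.2 r • b r) i| ^ 2 :=
          Finset.sum_congr rfl fun r _ => by rw [sq_abs, Pi.sub_apply]; ring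
      _ ≤ (∑ r, |y r i - (z'.2 r • b r) i|) ^ 2 :=
          Finset.sum_sq_le_sq_sum_of_nonneg fun r _ => abs_nonneg _
      _ ≤ (3 * T) ^ 2 :=
          pow_le_pow_left₀ (Finset.sum_nonneg fun r _ => abs_nonneg _) (hyle i) 2
  have hsplit : ∑ r, normSq (θ * W⁻¹) (z.1 r - y r) ≤
      2 * (X * (N * ρ * β⁻¹)) + 2 * ((∑ i, (θ * W⁻¹) i) * (3 * T) ^ 2) := by
    calc _ ≤ ∑ r, (2 * normSq (θ * W⁻¹) (z.1 r - z'.2 r • b r) +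
          2 * normSq (θ * W⁻¹) (z'.2 r • b r - y r)) := by
          refine Finset.sum_le_sum fun r _ => ?_
          have := normSq_add_le hV (z.1 r - z'.2 r • b r) (z'.2 r • b r - y r)
          rwa [sub_add_sub_cancel] at this
      _ ≤ _ := by
          rw [Finset.sum_add_distrib, ← Finset.mul_sum, ← Finset.mul_sum]
          gcongr
  have hSV0 : 0 ≤ ∑ i, (θ * W⁻¹) i := Finset.sum_nonneg fun i _ => hV i
  set m : ℝ := max 1 (9 * β⁻¹) with hm
  have hm1 : 1 ≤ m := le_max_left _ _
  have hmβ : 9 * β⁻¹ ≤ m := le_max_right _ _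
  have hN1 : (1 : ℝ) ≤ N := by exact_mod_cast hN
  have hA : (1 : ℝ) ≤ N ^ 2 * ρ := by nlinarith
  have hNA : N * ρ ≤ N ^ 2 * ρ := by nlinarith
  have hT2 : (∑ i, (θ * W⁻¹) i) * (3 * T) ^ 2 ≤
      18 * (N ^ 2 * ρ) * Y + 72 * (N ^ 2 * ρ * β⁻¹) * X := by
    calc (∑ i, (θ * W⁻¹) i) * (3 * T) ^ 2
        ≤ (∑ i, (θ * W⁻¹) i) * (9 * (2 * (β * SD) * Y + 8 * SD * X)) := by
          refine mul_le_mul_of_nonneg_left ?_ hSV0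
          linarith [hTle, mul_pow 3 T 2]
      _ = ((∑ i, (θ * W⁻¹) i) * SD) * (18 * β * Y + 72 * X) := by ring
      _ ≤ (N ^ 2 * ρ * β⁻¹) * (18 * β * Y + 72 * X) :=
          mul_le_mul_of_nonneg_right hSV (by positivity)
      _ = _ := by field_simp
  have hYm : N ^ 2 * ρ * Y ≤ N ^ 2 * ρ * m * Y := by
    refine mul_le_mul_of_nonneg_right ?_ hY0
    nlinarith
  have hc : 2 * (N * ρ * β⁻¹) + 144 * (N ^ 2 * ρ * β⁻¹) + 1 ≤ 36 * (N ^ 2 * ρ * m) := by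
    have h1 : N ^ 2 * ρ * (9 * β⁻¹) ≤ N ^ 2 * ρ * m := mul_le_mul_of_nonneg_left hmβ (by linarith)
    have h2 : N ^ 2 * ρ * 1 ≤ N ^ 2 * ρ * m := mul_le_mul_of_nonneg_left hm1 (by linarith)
    have h3 : N * ρ * β⁻¹ ≤ N ^ 2 * ρ * β⁻¹ :=
      mul_le_mul_of_nonneg_right hNA (inv_nonneg.2 hβ.le)
    linarith
  have hXc := mul_le_mul_of_nonneg_right hc hX0
  change ∑ r, normSq (θ * W⁻¹) (z.1 r - y r) + X ≤ 36 * (N ^ 2 * m * ρ) * (Y + X)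
  linarith

end Degrees


/-! ### Minimizers over the cones -/

section Minimizers

variable {N R : ℕ}

theorem zero_mem_cone {F : Finset (Fin N) → ℝ} (hF : IsSubmodular F) (h0 : F ∅ = 0) :
    (0 : (Fin N → ℝ) × ℝ) ∈ cone F :=
  ⟨le_rfl, (basePolytope_nonempty hF h0).imp fun b hb => ⟨hb, by simp⟩⟩

theorem convex_cone {F : Finset (Fin N) → ℝ} (hF : IsSubmodular F) (h0 : F ∅ = 0) :
    Convex ℝ (cone F) := by
  intro x hx y hy s t hs ht _
  rw [mem_cone_iff hF h0] at hx hy ⊢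
  have hsum : ∀ S : Finset (Fin N), ∑ i ∈ S, (s • x + t • y).1 i =
      s * ∑ i ∈ S, x.1 i + t * ∑ i ∈ S, y.1 i := fun S => by
    simp [Finset.sum_add_distrib, Finset.mul_sum]
  have hval : ∀ S, ((s • x + t • y).2 • F) S = s * (x.2 • F) S + t * (y.2 • F) S := fun S => by
    simp only [Prod.snd_add, Prod.smul_snd, Pi.smul_apply, smul_eq_mul]
    ring
  refine ⟨add_nonneg (mul_nonneg hs hx.1) (mul_nonneg ht hy.1), fun S => ?_, ?_⟩
  · rw [hsum, hval]
    exact add_le_add (mul_le_mul_of_nonneg_left (hx.2.1 S) hs)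
      (mul_le_mul_of_nonneg_left (hy.2.1 S) ht)
  · rw [hsum, hval, hx.2.2, hy.2.2]

theorem exists_isConicProj {F : Finset (Fin N) → ℝ} (hF : IsSubmodular F) (h0 : F ∅ = 0)
    {V : Fin N → ℝ} (hV : ∀ i, 0 ≤ V i) (b : Fin N → ℝ) : ∃ z, IsConicProj F V b z := by
  set f : (Fin N → ℝ) × ℝ → ℝ := fun z => normSq V (z.1 - b) + z.2 ^ 2 with hf
  have hfc : Continuous f := by
    simp only [hf, normSq, Pi.sub_apply]
    fun_prop
  set c : ℝ := √(f 0) with hc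
  have hf0 : 0 ≤ f 0 := add_nonneg (normSq_nonneg hV _) (sq_nonneg _)
  -- the part of the cone with `φ ≤ c` is a continuous image of `B × [0, c]`
  have hK : IsCompact ((fun p : (Fin N → ℝ) × ℝ => (p.2 • p.1, p.2)) ''
      (basePolytope F ×ˢ Set.Icc 0 c)) :=
    (isCompact_basePolytope.prod isCompact_Icc).image (by fun_prop)
  obtain ⟨b₀, hb₀⟩ := basePolytope_nonempty hF h0
  have h0K : (0 : (Fin N → ℝ) × ℝ) ∈ (fun p : (Fin N → ℝ) × ℝ => (p.2 • p.1, p.2)) ''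
      (basePolytope F ×ˢ Set.Icc 0 c) :=
    ⟨(b₀, 0), ⟨hb₀, le_rfl, Real.sqrt_nonneg _⟩, by simp⟩
  obtain ⟨z, hz, hmin⟩ := hK.exists_isMinOn ⟨0, h0K⟩ hfc.continuousOn
  refine ⟨z, ?_, fun z' hz' => ?_⟩
  · obtain ⟨⟨b', φ⟩, ⟨hb', hφ⟩, rfl⟩ := hz
    exact ⟨hφ.1, b', hb', rfl⟩
  · by_cases hle : z'.2 ≤ c
    · obtain ⟨h1, b', hb', h2⟩ := hz'
      exact hmin ⟨(b', z'.2), ⟨hb', h1, hle⟩, Prod.ext h2.symm rfl⟩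
    · have h1 : f z ≤ f 0 := hmin h0K
      have h2 : f 0 = c ^ 2 := (Real.sq_sqrt hf0).symm
      have h3 : c ^ 2 ≤ z'.2 ^ 2 := pow_le_pow_left₀ (Real.sqrt_nonneg _) (not_le.1 hle).le 2
      have h4 := normSq_nonneg hV (z'.1 - b)
      change f z ≤ _
      linarith

theorem isConicProj_conicProj {F : Finset (Fin N) → ℝ} (hF : IsSubmodular F) (h0 : F ∅ = 0)
    {V : Fin N → ℝ} (hV : ∀ i, 0 ≤ V i) (b : Fin N → ℝ) :
    IsConicProj F V b (conicProj F V b) :=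
  Classical.epsilon_spec (exists_isConicProj hF h0 hV b)

/-- The obtuse angle property of the projection onto the convex cone. -/
theorem IsConicProj.add_le {F : Finset (Fin N) → ℝ} (hF : IsSubmodular F) (h0 : F ∅ = 0)
    {V b : Fin N → ℝ} {p : (Fin N → ℝ) × ℝ} (hp : IsConicProj F V b p)
    {q : (Fin N → ℝ) × ℝ} (hq : q ∈ cone F) :
    normSq V (p.1 - b) + p.2 ^ 2 + (normSq V (p.1 - q.1) + (p.2 - q.2) ^ 2) ≤
      normSq V (q.1 - b) + q.2 ^ 2 := by
  have := nonneg_of_forall_quadratic_nonneg one_pos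
    (L := normSq V (q.1 - b) + q.2 ^ 2 - (normSq V (p.1 - b) + p.2 ^ 2) -
      (normSq V (p.1 - q.1) + (p.2 - q.2) ^ 2))
    (Q := normSq V (p.1 - q.1) + (p.2 - q.2) ^ 2) fun t ht ht1 => by
      have hmem := convex_cone hF h0 hp.1 hq (sub_nonneg.2 ht1) ht.le (by ring)
      have hle := hp.2 _ hmem
      have e : normSq V (((1 - t) • p + t • q).1 - b) + ((1 - t) • p + t • q).2 ^ 2 =
          normSq V (p.1 - b) + p.2 ^ 2 + (t * (normSq V (q.1 - b) + q.2 ^ 2 -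
            (normSq V (p.1 - b) + p.2 ^ 2) - (normSq V (p.1 - q.1) + (p.2 - q.2) ^ 2)) +
            t ^ 2 * (normSq V (p.1 - q.1) + (p.2 - q.2) ^ 2)) := by
        have e1 : normSq V (((1 - t) • p + t • q).1 - b) = normSq V (p.1 - b) +
            t * (normSq V (q.1 - b) - normSq V (p.1 - b) - normSq V (p.1 - q.1)) +
            t ^ 2 * normSq V (p.1 - q.1) := by
          simp only [normSq, Finset.mul_sum, ← Finset.sum_sub_distrib, ← Finset.sum_add_distrib]
          refine Finset.sum_congr rfl fun i _ => ?_
          simp only [Prod.fst_add, Prod.smul_fst, Pi.sub_apply, Pi.add_apply, Pi.smul_apply,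
            smul_eq_mul]
          ring
        rw [e1]
        simp only [Prod.snd_add, Prod.smul_snd, smul_eq_mul]
        ring
      linarith
  linarith

variable {F : Fin R → Finset (Fin N) → ℝ} {W a : Fin N → ℝ} {β : ℝ}

theorem IsProblem.zero_mem_prodCone (h : IsProblem F W β) : (0 : DualVar N R) ∈ prodCone F :=
  fun r => zero_mem_cone (h.submodular r) (h.map_empty r)

theorem IsProblem.inv_weight_nonneg (h : IsProblem F W β) (i : Fin N) : 0 ≤ W⁻¹ i :=
  inv_nonneg.2 (h.weight_pos i).le

theorem continuous_dualObj : Continuous (dualObj (N := N) (R := R) W a) := by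
  unfold dualObj normSq
  simp only [Pi.sub_apply, Finset.sum_apply]
  fun_prop

theorem isCompact_prodCone_inter (F : Fin R → Finset (Fin N) → ℝ) (c : ℝ) :
    IsCompact (prodCone F ∩ {z | ∀ r, z.2 r ≤ c}) := by
  have h : prodCone F ∩ {z | ∀ r, z.2 r ≤ c} =
      (fun p : DualVar N R => ((fun r => p.2 r • p.1 r, p.2) : DualVar N R)) ''
        ((Set.univ.pi fun r => basePolytope (F r)) ×ˢ
          (Set.univ.pi fun _ => Set.Icc 0 c)) := by
    ext z
    constructor
    · rintro ⟨hz, hc⟩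
      choose hz0 b hb hzb using hz
      exact ⟨(b, z.2), ⟨fun r _ => hb r, fun r _ => ⟨hz0 r, hc r⟩⟩,
        Prod.ext (funext fun r => (hzb r).symm) rfl⟩
    · rintro ⟨⟨b, φ⟩, ⟨hb, hφ⟩, rfl⟩
      exact ⟨fun r => ⟨(hφ r trivial).1, b r, hb r trivial, rfl⟩, fun r => (hφ r trivial).2⟩
  rw [h]
  exact ((isCompact_univ_pi fun r => isCompact_basePolytope).prod
    (isCompact_univ_pi fun _ => isCompact_Icc)).image (by fun_prop)

theorem IsProblem.le_sqrt_of_dualObj_le (h : IsProblem F W β) {z : DualVar N R}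
    (hz : dualObj W a z ≤ dualObj W a (0 : DualVar N R)) (r : Fin R) :
    z.2 r ≤ √(dualObj W a (0 : DualVar N R)) := by
  refine Real.le_sqrt_of_sq_le (le_trans ?_ hz)
  have h1 := Finset.single_le_sum (f := fun r => z.2 r ^ 2) (fun _ _ => sq_nonneg _)
    (Finset.mem_univ r)
  have h2 := normSq_nonneg h.inv_weight_nonneg (∑ r, z.1 r - 2 • (W * a))
  unfold dualObj
  linarith

theorem IsProblem.solutionSet_nonempty (h : IsProblem F W β) (a : Fin N → ℝ) :
    (solutionSet F W a).Nonempty := by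
  have h0 : (0 : DualVar N R) ∈
      prodCone F ∩ {z | ∀ r, z.2 r ≤ √(dualObj W a (0 : DualVar N R))} :=
    ⟨h.zero_mem_prodCone, fun r => Real.sqrt_nonneg _⟩
  obtain ⟨z, hz, hmin⟩ := (isCompact_prodCone_inter F _).exists_isMinOn ⟨0, h0⟩
    (continuous_dualObj (W := W) (a := a)).continuousOn
  refine ⟨z, hz.1, fun z' hz' => ?_⟩
  rcases le_total (dualObj W a z') (dualObj W a 0) with hle | hle
  · exact hmin ⟨hz', h.le_sqrt_of_dualObj_le hle⟩
  · exact le_trans (hmin h0) hle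

theorem IsProblem.isCompact_solutionSet (h : IsProblem F W β) :
    IsCompact (solutionSet F W a) := by
  obtain ⟨z₀, hz₀, hmin⟩ := h.solutionSet_nonempty a
  have e : solutionSet F W a =
      (prodCone F ∩ {z | ∀ r, z.2 r ≤ √(dualObj W a (0 : DualVar N R))}) ∩
        {z | dualObj W a z ≤ dualObj W a z₀} := by
    ext z
    constructor
    · rintro ⟨hz, hzm⟩
      exact ⟨⟨hz, h.le_sqrt_of_dualObj_le (hzm _ h.zero_mem_prodCone)⟩, hzm _ hz₀⟩
    · rintro ⟨⟨hz, _⟩, hle⟩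
      exact ⟨hz, fun z' hz' => le_trans hle (hmin z' hz')⟩
  rw [e]
  exact (isCompact_prodCone_inter F _).inter_right
    (isClosed_le continuous_dualObj continuous_const)

theorem optValue_eq {z : DualVar N R} (hz : z ∈ solutionSet F W a) :
    optValue F W a = dualObj W a z :=
  IsLeast.csInf_eq ⟨⟨z, hz.1, rfl⟩, by rintro _ ⟨z', hz', rfl⟩; exact hz.2 z' hz'⟩

theorem sqDist_nonneg {V : Fin N → ℝ} (hV : ∀ i, 0 ≤ V i) (z z' : DualVar N R) :
    0 ≤ sqDist V z z' :=
  add_nonneg (Finset.sum_nonneg fun _ _ => normSq_nonneg hV _)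
    (Finset.sum_nonneg fun _ _ => sq_nonneg _)

theorem wDist_sq_le {V : Fin N → ℝ} (hV : ∀ i, 0 ≤ V i) (z : DualVar N R)
    {X : Set (DualVar N R)} {z' : DualVar N R} (hz' : z' ∈ X) :
    wDist V z X ^ 2 ≤ sqDist V z z' := by
  unfold wDist
  rw [Real.sq_sqrt (Real.sInf_nonneg (by
    rintro _ ⟨x, _, rfl⟩
    exact sqDist_nonneg hV z x))]
  exact csInf_le ⟨0, by rintro _ ⟨x, _, rfl⟩; exact sqDist_nonneg hV z x⟩ ⟨z', hz', rfl⟩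

/-- The distance to the compact set of solutions is attained. -/
theorem IsProblem.exists_wDist_sq_eq (h : IsProblem F W β) {V : Fin N → ℝ} (hV : ∀ i, 0 ≤ V i)
    (z : DualVar N R) :
    ∃ z' ∈ solutionSet F W a, wDist V z (solutionSet F W a) ^ 2 = sqDist V z z' := by
  have hc : Continuous fun z' : DualVar N R => sqDist V z z' := by
    unfold sqDist normSq
    simp only [Pi.sub_apply]
    fun_prop
  obtain ⟨z', hz', hmin⟩ := h.isCompact_solutionSet.exists_isMinOn (h.solutionSet_nonempty a)
    hc.continuousOn
  refine ⟨z', hz', le_antisymm (wDist_sq_le hV z hz') ?_⟩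
  unfold wDist
  rw [Real.sq_sqrt (Real.sInf_nonneg (by
    rintro _ ⟨x, _, rfl⟩
    exact sqDist_nonneg hV z x))]
  exact le_csInf ⟨_, z', hz', rfl⟩ (by rintro _ ⟨x, hx, rfl⟩; exact hmin hx)

theorem IsProblem.quadGap_nonneg (h : IsProblem F W β) (z z' : DualVar N R) :
    0 ≤ quadGap W z z' :=
  add_nonneg (normSq_nonneg h.inv_weight_nonneg _) (Finset.sum_nonneg fun _ _ => sq_nonneg _)

/-- Quadratic growth of the dual objective above its minimum. -/
theorem IsProblem.quadGap_le (h : IsProblem F W β) {z z' : DualVar N R} (hz : z ∈ prodCone F)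
    (hz' : z' ∈ solutionSet F W a) : quadGap W z z' ≤ dualObj W a z - dualObj W a z' := by
  have := nonneg_of_forall_quadratic_nonneg one_pos
    (L := dualObj W a z - dualObj W a z' - quadGap W z z') (Q := quadGap W z z')
    fun t ht ht1 => by
      have hmem : (1 - t) • z' + t • z ∈ prodCone F := fun r =>
        convex_cone (h.submodular r) (h.map_empty r) (hz'.1 r) (hz r) (sub_nonneg.2 ht1) ht.le
          (by ring)
      have hle := hz'.2 _ hmem
      have e : dualObj W a ((1 - t) • z' + t • z) = dualObj W a z' +
          (t * (dualObj W a z - dualObj W a z' - quadGap W z z') + t ^ 2 * quadGap W z z') := by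
        have hsum : ∀ i, (∑ r, ((1 - t) • z' + t • z).1 r) i =
            (1 - t) * (∑ r, z'.1 r) i + t * (∑ r, z.1 r) i := fun i => by
          simp [Finset.sum_apply, Finset.sum_add_distrib, Finset.mul_sum]
        have e1 : normSq W⁻¹ (∑ r, ((1 - t) • z' + t • z).1 r - 2 • (W * a)) =
            normSq W⁻¹ (∑ r, z'.1 r - 2 • (W * a)) +
            (t * (normSq W⁻¹ (∑ r, z.1 r - 2 • (W * a)) -
              normSq W⁻¹ (∑ r, z'.1 r - 2 • (W * a)) - normSq W⁻¹ (∑ r, z.1 r - ∑ r, z'.1 r)) +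
            t ^ 2 * normSq W⁻¹ (∑ r, z.1 r - ∑ r, z'.1 r)) := by
          set s : Fin N → ℝ := ∑ r, z.1 r
          set s' : Fin N → ℝ := ∑ r, z'.1 r
          simp only [normSq, Finset.mul_sum, ← Finset.sum_sub_distrib, ← Finset.sum_add_distrib]
          refine Finset.sum_congr rfl fun i _ => ?_
          rw [Pi.sub_apply, hsum]
          simp only [Pi.sub_apply]
          ring
        have e2 : ∑ r, ((1 - t) • z' + t • z).2 r ^ 2 = ∑ r, z'.2 r ^ 2 +
            (t * (∑ r, z.2 r ^ 2 - ∑ r, z'.2 r ^ 2 - ∑ r, (z.2 r - z'.2 r) ^ 2) +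
            t ^ 2 * ∑ r, (z.2 r - z'.2 r) ^ 2) := by
          simp only [Finset.mul_sum, ← Finset.sum_sub_distrib, ← Finset.sum_add_distrib]
          refine Finset.sum_congr rfl fun r _ => ?_
          simp only [Prod.snd_add, Prod.smul_snd, Pi.add_apply, Pi.smul_apply, smul_eq_mul]
          ring
        unfold dualObj quadGap
        rw [e1, e2]
        ring
      linarith
  linarith

/-- The distance to the solutions is controlled by the discrepancy of block sums and `φ`-parts. -/
theorem IsProblem.wDist_sq_le_quadGap (h : IsProblem F W β) {θ : Fin N → ℝ} (hθ : ∀ i, 0 ≤ θ i)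
    {ρ : ℝ} (hρ1 : 1 ≤ ρ) (hρ : ∀ i j, θ j * degD F i ≤ ρ * degD F j) (hN : 0 < N)
    {z z' : DualVar N R} (hz : z ∈ prodCone F) (hz' : z' ∈ solutionSet F W a) :
    wDist (θ * W⁻¹) z (solutionSet F W a) ^ 2 ≤
      36 * (N ^ 2 * max 1 (9 * β⁻¹) * ρ) * quadGap W z z' := by
  obtain ⟨y, hy, hsum, hle⟩ := h.exists_sqDist_le hθ hρ1 hρ hN hz hz'.1
  refine (wDist_sq_le (fun i => mul_nonneg (hθ i) (h.inv_weight_nonneg i)) z ?_).trans hle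
  refine ⟨hy, fun x hx => ?_⟩
  have : dualObj W a (y, z'.2) = dualObj W a z' := by
    unfold dualObj
    rw [hsum]
  rw [this]
  exact hz'.2 x hx

/-! ### One step of random coordinate descent -/

theorem IsProblem.rcdStep_mem (h : IsProblem F W β) {z : DualVar N R} (hz : z ∈ prodCone F)
    (r : Fin R) : rcdStep F W a r z ∈ prodCone F := by
  intro r'
  rcases eq_or_ne r' r with rfl | hr
  · simpa [rcdStep] using (isConicProj_conicProj (h.submodular r') (h.map_empty r')
      h.inv_weight_nonneg _).1
  · simpa [rcdStep, hr] using hz r'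

/-- The dual objective as a function of the block `r`. -/
theorem dualObj_update (z : DualVar N R) (r : Fin R) (p : (Fin N → ℝ) × ℝ) :
    dualObj W a (Function.update z.1 r p.1, Function.update z.2 r p.2) =
      normSq W⁻¹ (p.1 - (2 • (W * a) - ∑ r' ∈ Finset.univ.erase r, z.1 r')) + p.2 ^ 2 +
        ∑ r' ∈ Finset.univ.erase r, z.2 r' ^ 2 := by
  have e1 : ∑ r', Function.update z.1 r p.1 r' =
      p.1 + ∑ r' ∈ Finset.univ.erase r, z.1 r' := by
    rw [← Finset.add_sum_erase _ _ (Finset.mem_univ r), Function.update_self]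
    congr 1
    exact Finset.sum_congr rfl fun r' hr' => Function.update_of_ne (Finset.ne_of_mem_erase hr') _ _
  have e2 : ∑ r', Function.update z.2 r p.2 r' ^ 2 =
      p.2 ^ 2 + ∑ r' ∈ Finset.univ.erase r, z.2 r' ^ 2 := by
    rw [← Finset.add_sum_erase _ _ (Finset.mem_univ r), Function.update_self]
    congr 1
    exact Finset.sum_congr rfl fun r' hr' => by
      rw [Function.update_of_ne (Finset.ne_of_mem_erase hr')]
  unfold dualObj
  simp only
  rw [e1, e2, add_assoc]
  congr 2
  abel

theorem sqDist_update (V : Fin N → ℝ) (z z' : DualVar N R) (r : Fin R)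
    (p : (Fin N → ℝ) × ℝ) :
    sqDist V (Function.update z.1 r p.1, Function.update z.2 r p.2) z' =
      sqDist V z z' - (normSq V (z.1 r - z'.1 r) + (z.2 r - z'.2 r) ^ 2) +
        (normSq V (p.1 - z'.1 r) + (p.2 - z'.2 r) ^ 2) := by
  have e1 : ∑ r', normSq V (Function.update z.1 r p.1 r' - z'.1 r') =
      ∑ r', normSq V (z.1 r' - z'.1 r') - normSq V (z.1 r - z'.1 r) +
        normSq V (p.1 - z'.1 r) := by
    rw [← Finset.add_sum_erase _ _ (Finset.mem_univ r), Function.update_self,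
      ← Finset.add_sum_erase Finset.univ (fun r' => normSq V (z.1 r' - z'.1 r'))
        (Finset.mem_univ r),
      Finset.sum_congr rfl fun r' hr' => by
        rw [Function.update_of_ne (Finset.ne_of_mem_erase hr')]]
    ring
  have e2 : ∑ r', (Function.update z.2 r p.2 r' - z'.2 r') ^ 2 =
      ∑ r', (z.2 r' - z'.2 r') ^ 2 - (z.2 r - z'.2 r) ^ 2 + (p.2 - z'.2 r) ^ 2 := by
    rw [← Finset.add_sum_erase _ _ (Finset.mem_univ r), Function.update_self,
      ← Finset.add_sum_erase Finset.univ (fun r' => (z.2 r' - z'.2 r') ^ 2)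
        (Finset.mem_univ r),
      Finset.sum_congr rfl fun r' hr' => by
        rw [Function.update_of_ne (Finset.ne_of_mem_erase hr')]]
    ring
  unfold sqDist
  simp only
  rw [e1, e2]
  ring

/-- One coordinate step, in terms of the partial derivative of the dual objective at `z` in the
direction `z' - z`. -/
theorem IsProblem.dualObj_add_sqDist_rcdStep_le (h : IsProblem F W β) (z : DualVar N R)
    {z' : DualVar N R} (hz' : z' ∈ prodCone F) (r : Fin R) :
    dualObj W a (rcdStep F W a r z) + sqDist W⁻¹ (rcdStep F W a r z) z' ≤
      dualObj W a z + sqDist W⁻¹ z z' +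
        (∑ i, W⁻¹ i * (2 * (∑ r, z.1 r - 2 • (W * a)) i * (z'.1 r i - z.1 r i)) +
          2 * z.2 r * (z'.2 r - z.2 r)) := by
  set b : Fin N → ℝ := 2 • (W * a) - ∑ r' ∈ Finset.univ.erase r, z.1 r' with hb
  have h1 := (isConicProj_conicProj (h.submodular r) (h.map_empty r) h.inv_weight_nonneg b).add_le
    (h.submodular r) (h.map_empty r) (hz' r)
  have h2 := dualObj_update (W := W) (a := a) z r (z.1 r, z.2 r)
  simp only [Function.update_eq_self] at h2
  rw [← hb] at h2
  have h3 : ∀ i, (z.1 r - b) i = (∑ r, z.1 r - 2 • (W * a)) i := fun i => by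
    rw [hb, ← Finset.add_sum_erase Finset.univ z.1 (Finset.mem_univ r)]
    simp only [Pi.sub_apply, Pi.add_apply]
    ring
  have h4 : normSq W⁻¹ (z'.1 r - b) + z'.2 r ^ 2 = normSq W⁻¹ (z.1 r - b) + z.2 r ^ 2 +
      (normSq W⁻¹ (z.1 r - z'.1 r) + (z.2 r - z'.2 r) ^ 2) +
      (∑ i, W⁻¹ i * (2 * (∑ r, z.1 r - 2 • (W * a)) i * (z'.1 r i - z.1 r i)) +
          2 * z.2 r * (z'.2 r - z.2 r)) := by
    have e : normSq W⁻¹ (z'.1 r - b) = normSq W⁻¹ (z.1 r - b) + normSq W⁻¹ (z.1 r - z'.1 r) +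
        ∑ i, W⁻¹ i * (2 * (∑ r, z.1 r - 2 • (W * a)) i * (z'.1 r i - z.1 r i)) := by
      unfold normSq
      rw [← Finset.sum_add_distrib, ← Finset.sum_add_distrib]
      refine Finset.sum_congr rfl fun i _ => ?_
      rw [← h3 i]
      simp only [Pi.sub_apply]
      ring
    rw [e]
    ring
  have h5 : rcdStep F W a r z = (Function.update z.1 r (conicProj (F r) W⁻¹ b).1,
      Function.update z.2 r (conicProj (F r) W⁻¹ b).2) := rfl
  rw [h5, dualObj_update, sqDist_update, ← hb]
  linarith

theorem sum_partial_eq (z z' : DualVar N R) :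
    ∑ r, (∑ i, W⁻¹ i * (2 * (∑ r, z.1 r - 2 • (W * a)) i * (z'.1 r i - z.1 r i)) +
        2 * z.2 r * (z'.2 r - z.2 r)) =
      dualObj W a z' - dualObj W a z - quadGap W z z' := by
  have e1 : ∑ r, ∑ i, W⁻¹ i * (2 * (∑ r, z.1 r - 2 • (W * a)) i * (z'.1 r i - z.1 r i)) =
      normSq W⁻¹ (∑ r, z'.1 r - 2 • (W * a)) - normSq W⁻¹ (∑ r, z.1 r - 2 • (W * a)) -
        normSq W⁻¹ (∑ r, z.1 r - ∑ r, z'.1 r) := by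
    unfold normSq
    rw [Finset.sum_comm, ← Finset.sum_sub_distrib, ← Finset.sum_sub_distrib]
    refine Finset.sum_congr rfl fun i _ => ?_
    rw [← Finset.mul_sum, ← Finset.mul_sum, Finset.sum_sub_distrib]
    simp only [Pi.sub_apply, Finset.sum_apply]
    ring
  have e2 : ∑ r, 2 * z.2 r * (z'.2 r - z.2 r) =
      ∑ r, z'.2 r ^ 2 - ∑ r, z.2 r ^ 2 - ∑ r, (z.2 r - z'.2 r) ^ 2 := by
    rw [← Finset.sum_sub_distrib, ← Finset.sum_sub_distrib]
    exact Finset.sum_congr rfl fun r _ => by ring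
  rw [Finset.sum_add_distrib, e1, e2]
  unfold dualObj quadGap
  ring

/-- The potential of random coordinate descent: the optimality gap of `z` plus its squared
distance to the solutions. -/
noncomputable def potential (F : Fin R → Finset (Fin N) → ℝ) (W a : Fin N → ℝ)
    (z : DualVar N R) : ℝ :=
  dualObj W a z - optValue F W a + wDist W⁻¹ z (solutionSet F W a) ^ 2

theorem IsProblem.wDist_sq_le_potential (h : IsProblem F W β) {z : DualVar N R}
    (hz : z ∈ prodCone F) : wDist W⁻¹ z (solutionSet F W a) ^ 2 ≤ potential F W a z := by
  obtain ⟨z', hz'⟩ := h.solutionSet_nonempty a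
  have h1 := hz'.2 z hz
  rw [← optValue_eq hz'] at h1
  unfold potential
  linarith

theorem IsProblem.potential_nonneg (h : IsProblem F W β) {z : DualVar N R}
    (hz : z ∈ prodCone F) : 0 ≤ potential F W a z :=
  (sq_nonneg _).trans (h.wDist_sq_le_potential hz)

/-- Averaged over the choice of the block, a coordinate step contracts the potential. -/
theorem IsProblem.sum_potential_rcdStep_le (h : IsProblem F W β) {κ : ℝ} (hκ : 1 ≤ κ)
    {z : DualVar N R} (hz : z ∈ prodCone F)
    (herr : ∀ z' ∈ solutionSet F W a,
      wDist W⁻¹ z (solutionSet F W a) ^ 2 ≤ κ * quadGap W z z') :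
    ∑ r, potential F W a (rcdStep F W a r z) ≤ (R - 1 / (2 * κ)) * potential F W a z := by
  obtain ⟨z', hz', hdist⟩ := h.exists_wDist_sq_eq (a := a) h.inv_weight_nonneg z
  have h1 : ∀ r, potential F W a (rcdStep F W a r z) ≤ potential F W a z +
      (∑ i, W⁻¹ i * (2 * (∑ r, z.1 r - 2 • (W * a)) i * (z'.1 r i - z.1 r i)) +
          2 * z.2 r * (z'.2 r - z.2 r)) := fun r => by
    have := h.dualObj_add_sqDist_rcdStep_le (a := a) z hz'.1 r
    have h2 := wDist_sq_le h.inv_weight_nonneg (rcdStep F W a r z) hz'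
    unfold potential
    linarith
  have h2 : ∑ r, potential F W a (rcdStep F W a r z) ≤ R * potential F W a z +
      (dualObj W a z' - dualObj W a z - quadGap W z z') := by
    refine (Finset.sum_le_sum fun r _ => h1 r).trans (le_of_eq ?_)
    rw [Finset.sum_add_distrib, sum_partial_eq]
    simp
  have h3 := h.quadGap_le hz hz'
  have h4 := herr z' hz'
  have h5 : 1 / (2 * κ) * potential F W a z ≤ dualObj W a z - dualObj W a z' + quadGap W z z' := by
    rw [div_mul_eq_mul_div, one_mul, div_le_iff₀ (by positivity)]
    unfold potential
    rw [optValue_eq hz']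
    have h6 := h.quadGap_nonneg z z'
    nlinarith
  linarith

/-! ### One step of alternating projections -/

theorem IsProblem.apStep_mem (h : IsProblem F W β) (z : DualVar N R) :
    apStep F W a z ∈ prodCone F := fun r =>
  (isConicProj_conicProj (h.submodular r) (h.map_empty r)
    (fun i => mul_nonneg (zero_le_one.trans (h.one_le_degPsi i)) (h.inv_weight_nonneg i)) _).1

theorem apply_eq_zero_of_mem_prodCone (h0 : ∀ r, F r ∅ = 0) {z : DualVar N R}
    (hz : z ∈ prodCone F) {r : Fin R} {i : Fin N} (hi : ¬ IsIncident (F r) i) : z.1 r i = 0 := by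
  obtain ⟨_, b, hb, hzb⟩ := hz r
  have : z.1 r = z.2 r • b := hzb
  rw [this, Pi.smul_apply, apply_eq_zero_of_not_isIncident hb (h0 r) hi, smul_zero]

open Classical in
/-- For `z = (y, φ)` in the product of the cones, the projection of `y`, in the metric of `Ψ W⁻¹`,
onto the families with sum `2 W a` that are supported on the incident elements. -/
noncomputable def apTarget (F : Fin R → Finset (Fin N) → ℝ) (W a : Fin N → ℝ)
    (z : DualVar N R) (r : Fin R) (i : Fin N) : ℝ :=
  if IsIncident (F r) i then z.1 r i - (degPsi F i)⁻¹ * (∑ r, z.1 r - 2 • (W * a)) i else 0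

theorem IsProblem.apStep_eq (h : IsProblem F W β) (z : DualVar N R) :
    apStep F W a z = (fun r => (conicProj (F r) (degPsi F * W⁻¹) (apTarget F W a z r)).1,
      fun r => (conicProj (F r) (degPsi F * W⁻¹) (apTarget F W a z r)).2) := by
  have e : apTarget F W a z = fun r i =>
      @ite _ (IsIncident (F r) i) (Classical.propDecidable _)
        (z.1 r i - (1 / 2) * ((degPsi F i)⁻¹ * W i * (2 • (W⁻¹ * ∑ r, z.1 r) - 4 • a) i)) 0 := by
    ext r i
    unfold apTarget
    split_ifs with hi
    · have := (h.weight_pos i).ne'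
      simp only [Pi.sub_apply, Pi.smul_apply, Pi.mul_apply, Pi.inv_apply]
      simp only [nsmul_eq_mul]
      push_cast
      field_simp
      ring
    · rfl
  rw [e]
  rfl

open Classical in
theorem sum_ite_isIncident (F : Fin R → Finset (Fin N) → ℝ) (i : Fin N) (c : ℝ) :
    ∑ r, (if IsIncident (F r) i then c else 0) = degPsi F i * c := by
  rw [← Finset.sum_filter, Finset.sum_const, nsmul_eq_mul]
  rfl

theorem IsProblem.sum_apTarget (h : IsProblem F W β) {z : DualVar N R} (hz : z ∈ prodCone F)
    (i : Fin N) : ∑ r, apTarget F W a z r i = (2 • (W * a)) i := by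
  classical
  have e : ∀ r, apTarget F W a z r i = z.1 r i - if IsIncident (F r) i then
      (degPsi F i)⁻¹ * (∑ r, z.1 r - 2 • (W * a)) i else 0 := fun r => by
    unfold apTarget
    split_ifs with hi
    · rfl
    · rw [apply_eq_zero_of_mem_prodCone h.map_empty hz hi, sub_zero]
  have hΨ : degPsi F i ≠ 0 := (zero_lt_one.trans_le (h.one_le_degPsi i)).ne'
  rw [Finset.sum_congr rfl fun r _ => e r, Finset.sum_sub_distrib, sum_ite_isIncident,
    mul_inv_cancel_left₀ hΨ, Pi.sub_apply, Finset.sum_apply]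
  ring

/-- The distance to the target majorizes the first part of the dual objective. -/
theorem IsProblem.normSq_sum_le (h : IsProblem F W β) {z x : DualVar N R}
    (hz : z ∈ prodCone F) (hx : x ∈ prodCone F) :
    normSq W⁻¹ (∑ r, x.1 r - 2 • (W * a)) ≤
      ∑ r, normSq (degPsi F * W⁻¹) (x.1 r - apTarget F W a z r) := by
  classical
  unfold normSq
  rw [Finset.sum_comm]
  refine Finset.sum_le_sum fun i _ => ?_
  have e : (∑ r, x.1 r - 2 • (W * a)) i = ∑ r with IsIncident (F r) i,
      (x.1 r - apTarget F W a z r) i := by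
    rw [Finset.sum_filter_of_ne, Pi.sub_apply, ← h.sum_apTarget hz, Finset.sum_apply,
      ← Finset.sum_sub_distrib]
    · rfl
    · intro r _ hne
      by_contra hi
      exact hne (by simp [apTarget, hi, apply_eq_zero_of_mem_prodCone h.map_empty hx hi])
  rw [e, ← Finset.mul_sum, Pi.mul_apply, mul_comm (degPsi F i), mul_assoc]
  refine mul_le_mul_of_nonneg_left ?_ (h.inv_weight_nonneg i)
  refine sq_sum_le_card_mul_sum_sq.trans ?_
  refine mul_le_mul_of_nonneg_left ?_ (zero_le_one.trans (h.one_le_degPsi i))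
  exact Finset.sum_le_sum_of_subset_of_nonneg (Finset.filter_subset _ _)
    fun _ _ _ => sq_nonneg _

/-- The error of the majorization is the excess of the distance in the metric of `Ψ W⁻¹` over
the discrepancy of the block sums. -/
theorem IsProblem.sum_normSq_sub_apTarget (h : IsProblem F W β) {z x : DualVar N R}
    (hz : z ∈ prodCone F) (hx : x ∈ prodCone F) :
    ∑ r, normSq (degPsi F * W⁻¹) (x.1 r - apTarget F W a z r) =
      normSq W⁻¹ (∑ r, x.1 r - 2 • (W * a)) +
        ∑ r, normSq (degPsi F * W⁻¹) (z.1 r - x.1 r) -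
        normSq W⁻¹ (∑ r, z.1 r - ∑ r, x.1 r) := by
  classical
  unfold normSq
  rw [Finset.sum_comm, Finset.sum_comm (s := Finset.univ (α := Fin R)),
    ← Finset.sum_add_distrib, ← Finset.sum_sub_distrib]
  refine Finset.sum_congr rfl fun i _ => ?_
  set s : ℝ := (∑ r, z.1 r - 2 • (W * a)) i with hs
  have hΨ : degPsi F i ≠ 0 := (zero_lt_one.trans_le (h.one_le_degPsi i)).ne'
  have e1 : ∀ r, (x.1 r - apTarget F W a z r) i ^ 2 = (z.1 r - x.1 r) i ^ 2 +
      2 * (degPsi F i)⁻¹ * s * (x.1 r i - z.1 r i) +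
      if IsIncident (F r) i then (degPsi F i)⁻¹ ^ 2 * s ^ 2 else 0 := fun r => by
    by_cases hi : IsIncident (F r) i
    · simp only [apTarget, hi, if_true, Pi.sub_apply] at hs ⊢
      rw [← hs]
      ring
    · simp [apTarget, hi, apply_eq_zero_of_mem_prodCone h.map_empty hx hi,
        apply_eq_zero_of_mem_prodCone h.map_empty hz hi]
  have e2 : (∑ r, x.1 r - 2 • (W * a)) i = s + ∑ r, (x.1 r i - z.1 r i) := by
    rw [hs, Finset.sum_sub_distrib]
    simp only [Pi.sub_apply, Finset.sum_apply]
    ring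
  have e3 : (∑ r, z.1 r - ∑ r, x.1 r) i = - ∑ r, (x.1 r i - z.1 r i) := by
    rw [Finset.sum_sub_distrib]
    simp only [Pi.sub_apply, Finset.sum_apply]
    ring
  rw [e2, e3, ← Finset.mul_sum, ← Finset.mul_sum, Finset.sum_congr rfl fun r _ => e1 r,
    Finset.sum_add_distrib, Finset.sum_add_distrib, ← Finset.mul_sum, sum_ite_isIncident,
    Pi.mul_apply]
  field_simp
  ring

/-- An alternating projection step contracts the squared distance to the solutions. -/
theorem IsProblem.wDist_sq_apStep_le (h : IsProblem F W β) {κ : ℝ} (hκ : 0 < κ)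
    {z : DualVar N R} (hz : z ∈ prodCone F)
    (herr : ∀ z' ∈ solutionSet F W a,
      wDist (degPsi F * W⁻¹) z (solutionSet F W a) ^ 2 ≤ κ * quadGap W z z') :
    wDist (degPsi F * W⁻¹) (apStep F W a z) (solutionSet F W a) ^ 2 ≤
      (1 - 1 / κ) * wDist (degPsi F * W⁻¹) z (solutionSet F W a) ^ 2 := by
  have hV : ∀ i, 0 ≤ (degPsi F * W⁻¹) i := fun i =>
    mul_nonneg (zero_le_one.trans (h.one_le_degPsi i)) (h.inv_weight_nonneg i)
  obtain ⟨z', hz', hdist⟩ := h.exists_wDist_sq_eq (a := a) hV z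
  have hmem := h.apStep_mem (a := a) z
  have h1 := wDist_sq_le hV (apStep F W a z) hz'
  have h2 : ∑ r, normSq (degPsi F * W⁻¹) ((apStep F W a z).1 r - apTarget F W a z r) +
      ∑ r, (apStep F W a z).2 r ^ 2 + sqDist (degPsi F * W⁻¹) (apStep F W a z) z' ≤
      ∑ r, normSq (degPsi F * W⁻¹) (z'.1 r - apTarget F W a z r) + ∑ r, z'.2 r ^ 2 := by
    have hp := Finset.sum_le_sum fun r (_ : r ∈ Finset.univ) =>
      (isConicProj_conicProj (h.submodular r) (h.map_empty r) hV (apTarget F W a z r)).add_le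
        (h.submodular r) (h.map_empty r) (hz'.1 r)
    simp only [Finset.sum_add_distrib] at hp
    unfold sqDist
    rw [h.apStep_eq]
    exact hp
  have h3 := h.normSq_sum_le (a := a) hz hmem
  have h4 := h.sum_normSq_sub_apTarget (a := a) hz hz'.1
  have h5 := hz'.2 _ hmem
  have h6 := herr z' hz'
  have h7 : 1 / κ * wDist (degPsi F * W⁻¹) z (solutionSet F W a) ^ 2 ≤ quadGap W z z' := by
    rw [div_mul_eq_mul_div, one_mul, div_le_iff₀ hκ]
    linarith
  unfold dualObj at h5
  unfold quadGap at h7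
  rw [sub_mul, one_mul]
  have h8 : wDist (degPsi F * W⁻¹) z (solutionSet F W a) ^ 2 =
      ∑ r, normSq (degPsi F * W⁻¹) (z.1 r - z'.1 r) + ∑ r, (z.2 r - z'.2 r) ^ 2 := hdist
  linarith

end Minimizers


/-! ### Expectations along random coordinate descent -/

section Random

variable {N R : ℕ} {F : Fin R → Finset (Fin N) → ℝ} {W a : Fin N → ℝ} {β : ℝ}

theorem IsProblem.rcd_mem (h : IsProblem F W β) (idx : ℕ → Fin R) (k : ℕ) :
    rcd F W a idx k ∈ prodCone F := by
  induction k with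
  | zero => exact h.zero_mem_prodCone
  | succ k ih => exact h.rcdStep_mem ih _

theorem rcd_congr {idx idx' : ℕ → Fin R} {k : ℕ} (h : ∀ j < k, idx j = idx' j) :
    rcd F W a idx k = rcd F W a idx' k := by
  induction k with
  | zero => rfl
  | succ k ih =>
    simp only [rcd]
    rw [ih fun j hj => h j (hj.trans k.lt_succ_self), h k k.lt_succ_self]

/-- The iterate `k` is a function of the first `k` picks, which take finitely many values. -/
theorem exists_rcd_eq {Ω : Type*} (F : Fin R → Finset (Fin N) → ℝ) (W a : Fin N → ℝ) (r₀ : Fin R)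
    (idx : ℕ → Ω → Fin R) (k : ℕ) :
    ∃ H : (Finset.range k → Fin R) → DualVar N R, ∀ ω,
      rcd F W a (fun j => idx j ω) k = H fun j => idx j ω := by
  refine ⟨fun p => rcd F W a (fun j => if hj : j ∈ Finset.range k then p ⟨j, hj⟩ else r₀) k,
    fun ω => rcd_congr fun j hj => ?_⟩
  simp [hj]

variable {Ω : Type*} [MeasurableSpace Ω] {P : Measure Ω} {idx : ℕ → Ω → Fin R}

theorem measurable_comp_rcd (r₀ : Fin R) (hidx : ∀ k, Measurable (idx k)) (k : ℕ)
    (f : DualVar N R → ℝ≥0∞) :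
    Measurable fun ω => f (rcd F W a (fun j => idx j ω) k) := by
  obtain ⟨H, hH⟩ := exists_rcd_eq F W a r₀ idx k
  simp only [hH]
  have h1 : Measurable fun p : Finset.range k → Fin R => f (H p) := .of_discrete
  exact h1.comp (measurable_pi_lambda _ fun j => hidx j)

/-- The pick of iteration `k` is uniform and independent of iterate `k`. -/
theorem lintegral_rcd_succ (r₀ : Fin R) (hidx : ∀ k, Measurable (idx k))
    (hind : iIndepFun idx P) (hunif : ∀ k r, P (idx k ⁻¹' {r}) = (R : ℝ≥0∞)⁻¹) (k : ℕ)
    (f : DualVar N R → ℝ≥0∞) :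
    ∫⁻ ω, f (rcd F W a (fun j => idx j ω) (k + 1)) ∂P =
      ∫⁻ ω, (R : ℝ≥0∞)⁻¹ *
        ∑ r, f (rcdStep F W a r (rcd F W a (fun j => idx j ω) k)) ∂P := by
  classical
  have e : ∀ ω, f (rcd F W a (fun j => idx j ω) (k + 1)) =
      ∑ r, (idx k ⁻¹' {r}).indicator 1 ω *
        f (rcdStep F W a r (rcd F W a (fun j => idx j ω) k)) := by
    intro ω
    rw [Finset.sum_eq_single (idx k ω)]
    · simp [rcd]
    · intro r _ hr
      simp [Set.indicator, hr.symm]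
    · simp
  have hm : ∀ r, Measurable fun ω =>
      f (rcdStep F W a r (rcd F W a (fun j => idx j ω) k)) := fun r =>
    measurable_comp_rcd r₀ hidx k fun z => f (rcdStep F W a r z)
  have hm' : ∀ r, Measurable ((idx k ⁻¹' {r}).indicator (1 : Ω → ℝ≥0∞)) := fun r =>
    measurable_one.indicator (hidx k (measurableSet_singleton r))
  have hindep : ∀ r, IndepFun ((idx k ⁻¹' {r}).indicator (1 : Ω → ℝ≥0∞))
      (fun ω => f (rcdStep F W a r (rcd F W a (fun j => idx j ω) k))) P := by
    intro r
    obtain ⟨H, hH⟩ := exists_rcd_eq F W a r₀ idx k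
    have h1 := hind.indepFun_finset {k} (Finset.range k) (by simp) hidx
    have h2 := h1.comp (φ := fun p : ({k} : Finset ℕ) → Fin R =>
        (({r} : Set (Fin R)).indicator 1 (p ⟨k, by simp⟩) : ℝ≥0∞))
      (ψ := fun p => f (rcdStep F W a r (H p))) .of_discrete .of_discrete
    simp only [hH]
    exact h2
  simp only [e]
  refine (lintegral_finsetSum _ fun r _ => (hm' r).mul (hm r)).trans ?_
  rw [lintegral_const_mul _ (Finset.measurable_sum _ fun r _ => hm r),
    lintegral_finsetSum _ fun r _ => hm r, Finset.mul_sum]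
  refine Finset.sum_congr rfl fun r _ => ?_
  have := lintegral_mul_eq_lintegral_mul_lintegral_of_indepFun (hm' r) (hm r) (hindep r)
  rw [← hunif k r, ← lintegral_indicator_one (hidx k (measurableSet_singleton r))]
  exact this

theorem IsProblem.lintegral_potential_rcd_le [IsProbabilityMeasure P] (h : IsProblem F W β)
    (r₀ : Fin R) (hidx : ∀ k, Measurable (idx k)) (hind : iIndepFun idx P)
    (hunif : ∀ k r, P (idx k ⁻¹' {r}) = (R : ℝ≥0∞)⁻¹) {κ : ℝ} (hκ : 1 ≤ κ)
    (herr : ∀ z ∈ prodCone F, ∀ z' ∈ solutionSet F W a,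
      wDist W⁻¹ z (solutionSet F W a) ^ 2 ≤ κ * quadGap W z z') (k : ℕ) :
    ∫⁻ ω, ENNReal.ofReal (potential F W a (rcd F W a (fun j => idx j ω) k)) ∂P ≤
      ENNReal.ofReal ((1 - 1 / (2 * κ * R)) ^ k * potential F W a (0 : DualVar N R)) := by
  have hR : (1 : ℝ) ≤ R := by exact_mod_cast r₀.pos
  have hκR : 1 ≤ 2 * κ * R := by nlinarith
  have hq : 0 ≤ 1 - 1 / (2 * κ * R) := sub_nonneg.2 ((div_le_one (by linarith)).2 hκR)
  induction k with
  | zero => simp [rcd]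
  | succ k ih =>
    rw [lintegral_rcd_succ r₀ hidx hind hunif k fun z => ENNReal.ofReal (potential F W a z)]
    calc _ ≤ ∫⁻ ω, ENNReal.ofReal (1 - 1 / (2 * κ * R)) *
          ENNReal.ofReal (potential F W a (rcd F W a (fun j => idx j ω) k)) ∂P := by
          refine lintegral_mono fun ω => ?_
          have hz := h.rcd_mem (a := a) (fun j => idx j ω) k
          have hRinv : (R : ℝ≥0∞)⁻¹ = ENNReal.ofReal (R : ℝ)⁻¹ := by
            rw [ENNReal.ofReal_inv_of_pos (by linarith), ENNReal.ofReal_natCast]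
          simp only
          rw [← ENNReal.ofReal_sum_of_nonneg fun r _ => h.potential_nonneg (h.rcdStep_mem hz r),
            hRinv, ← ENNReal.ofReal_mul (by positivity), ← ENNReal.ofReal_mul hq]
          refine ENNReal.ofReal_le_ofReal ?_
          have := mul_le_mul_of_nonneg_left (h.sum_potential_rcdStep_le hκ hz (herr _ hz))
            (inv_nonneg.2 (zero_le_one.trans hR))
          refine this.trans (le_of_eq ?_)
          have : (R : ℝ) ≠ 0 := by linarith
          field_simp
      _ ≤ ENNReal.ofReal (1 - 1 / (2 * κ * R)) * ENNReal.ofReal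
          ((1 - 1 / (2 * κ * R)) ^ k * potential F W a (0 : DualVar N R)) := by
          rw [lintegral_const_mul _ (measurable_comp_rcd r₀ hidx k
            fun z => ENNReal.ofReal (potential F W a z))]
          gcongr
      _ = _ := by
          rw [← ENNReal.ofReal_mul hq, pow_succ']
          congr 1
          ring

/-- After `m` iterations, every further iteration before the hitting time contributes at least
`1` to the sum of the squared distances divided by `ε ^ 2`. -/
theorem hitTime_le (V : Fin N → ℝ) (X : Set (DualVar N R)) {ε : ℝ} (hε : 0 < ε)
    (z : ℕ → DualVar N R) (m : ℕ) :
    hitTime V X ε z ≤ m + ∑' j, ENNReal.ofReal ((ε ^ 2)⁻¹ * wDist V (z (m + j)) X ^ 2) := by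
  classical
  have hone : ∀ j, ¬ wDist V (z (m + j)) X ≤ ε →
      1 ≤ ENNReal.ofReal ((ε ^ 2)⁻¹ * wDist V (z (m + j)) X ^ 2) := fun j hj => by
    rw [← ENNReal.ofReal_one]
    refine ENNReal.ofReal_le_ofReal ?_
    rw [inv_mul_eq_div, one_le_div (by positivity)]
    exact pow_le_pow_left₀ hε.le (not_le.1 hj).le 2
  by_cases hex : ∃ j, wDist V (z (m + j)) X ≤ ε
  · have h1 : hitTime V X ε z ≤ ((m + Nat.find hex : ℕ) : ℝ≥0∞) :=
      iInf₂_le (m + Nat.find hex) (Nat.find_spec hex)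
    refine h1.trans ?_
    push_cast
    gcongr
    calc ((Nat.find hex : ℕ) : ℝ≥0∞) = ∑ _j ∈ Finset.range (Nat.find hex), 1 := by simp
      _ ≤ ∑ j ∈ Finset.range (Nat.find hex),
          ENNReal.ofReal ((ε ^ 2)⁻¹ * wDist V (z (m + j)) X ^ 2) :=
          Finset.sum_le_sum fun j hj => hone j (Nat.find_min hex (Finset.mem_range.1 hj))
      _ ≤ _ := ENNReal.sum_le_tsum _
  · have htop : (⊤ : ℝ≥0∞) ≤ ∑' j, ENNReal.ofReal ((ε ^ 2)⁻¹ * wDist V (z (m + j)) X ^ 2) := by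
      rw [← ENNReal.tsum_const_eq_top_of_ne_zero (α := ℕ) one_ne_zero]
      exact ENNReal.tsum_le_tsum fun j => hone j fun hj => hex ⟨j, hj⟩
    rw [top_le_iff.1 htop, add_top]
    exact le_top

end Random

/-! ### Convergence rates -/

theorem one_sub_inv_pow_le {x ε : ℝ} (hx : 1 ≤ x) (hε : 0 < ε) {n k : ℕ}
    (hk : n * x * Real.log (1 / ε) ≤ k) : (1 - 1 / x) ^ k ≤ ε ^ n := by
  have hx0 : 0 < x := by linarith
  have h1 : 1 - 1 / x ≤ Real.exp (-(1 / x)) := by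
    have := Real.add_one_le_exp (-(1 / x))
    linarith
  calc (1 - 1 / x) ^ k ≤ Real.exp (-(1 / x)) ^ k :=
        pow_le_pow_left₀ (sub_nonneg.2 ((div_le_one hx0).2 hx)) h1 k
    _ = Real.exp (-(k / x)) := by
        rw [← Real.exp_nat_mul]
        congr 1
        ring
    _ ≤ Real.exp (n * Real.log ε) := by
        rw [Real.exp_le_exp]
        have h2 : n * Real.log (1 / ε) ≤ k / x := by
          rw [le_div_iff₀ hx0]
          linarith
        rw [one_div, Real.log_inv] at h2
        linarith
    _ = ε ^ n := by rw [Real.exp_nat_mul, Real.exp_log hε]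

theorem half_le_log_one_div {ε : ℝ} (hε : 0 < ε) (hε2 : ε ≤ 1 / 2) :
    1 / 2 ≤ Real.log (1 / ε) := by
  have h1 : (2 : ℝ) ≤ 1 / ε := by
    rw [le_div_iff₀ hε]
    linarith
  have h2 := Real.log_le_log two_pos h1
  have h3 := Real.log_two_gt_d9
  linarith

section Rates

variable {N R : ℕ} {F : Fin R → Finset (Fin N) → ℝ} {W a : Fin N → ℝ} {β : ℝ}

theorem IsProblem.exists_rcdBound_eq (h : IsProblem F W β) (hN : 0 < N) :
    ∃ κ : ℝ, 1 ≤ κ ∧ 2 * κ * R = 72 * rcdBound F β ∧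
      ∀ z ∈ prodCone F, ∀ z' ∈ solutionSet F W a,
        wDist W⁻¹ z (solutionSet F W a) ^ 2 ≤ κ * quadGap W z z' := by
  set ρ : ℝ := ⨆ p : Fin N × Fin N, degD F p.1 / degD F p.2 with hρ
  have hle : ∀ i j, degD F i / degD F j ≤ ρ := fun i j =>
    le_ciSup (f := fun p : Fin N × Fin N => degD F p.1 / degD F p.2)
      (Set.finite_range _).bddAbove (i, j)
  have hρ1 : 1 ≤ ρ := by
    have := hle ⟨0, hN⟩ ⟨0, hN⟩
    rwa [div_self (h.degD_pos _).ne'] at this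
  have hm : 1 ≤ max 1 (9 * β⁻¹) := le_max_left _ _
  have hN1 : (1 : ℝ) ≤ N ^ 2 := one_le_pow₀ (by exact_mod_cast hN)
  refine ⟨36 * (N ^ 2 * max 1 (9 * β⁻¹) * ρ), ?_, ?_, fun z hz z' hz' => ?_⟩
  · have := one_le_mul_of_one_le_of_one_le (one_le_mul_of_one_le_of_one_le hN1 hm) hρ1
    linarith
  · unfold rcdBound
    ring
  · have := h.wDist_sq_le_quadGap (θ := 1) (fun _ => zero_le_one) hρ1
      (fun i j => by
        rw [Pi.one_apply, one_mul]
        exact (div_le_iff₀ (h.degD_pos j)).1 (hle i j)) hN hz hz'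
    rwa [one_mul] at this

theorem IsProblem.one_le_apBound (h : IsProblem F W β) (hN : 0 < N) (hR : 0 < R) :
    1 ≤ apBound F β ∧ ∀ z ∈ prodCone F, ∀ z' ∈ solutionSet F W a,
      wDist (degPsi F * W⁻¹) z (solutionSet F W a) ^ 2 ≤ 36 * apBound F β * quadGap W z z' := by
  have hR0 : (0 : ℝ) < R := by exact_mod_cast hR
  set ρ : ℝ := R * ⨆ p : Fin N × Fin N, degPsi F p.2 / R * (degD F p.1 / degD F p.2) with hρ
  have hle : ∀ i j, degPsi F j * (degD F i / degD F j) ≤ ρ := fun i j => by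
    have := le_ciSup
      (f := fun p : Fin N × Fin N => degPsi F p.2 / R * (degD F p.1 / degD F p.2))
      (Set.finite_range _).bddAbove (i, j)
    refine le_trans (le_of_eq ?_) (mul_le_mul_of_nonneg_left this hR0.le)
    field_simp
  have hρ1 : 1 ≤ ρ := by
    have := hle ⟨0, hN⟩ ⟨0, hN⟩
    rw [div_self (h.degD_pos _).ne', mul_one] at this
    exact (h.one_le_degPsi _).trans this
  have hm : 1 ≤ max 1 (9 * β⁻¹) := le_max_left _ _
  have hN1 : (1 : ℝ) ≤ N ^ 2 := one_le_pow₀ (by exact_mod_cast hN)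
  have e : apBound F β = N ^ 2 * max 1 (9 * β⁻¹) * ρ := by
    unfold apBound
    rw [hρ]
    ring
  rw [e]
  refine ⟨one_le_mul_of_one_le_of_one_le (one_le_mul_of_one_le_of_one_le hN1 hm) hρ1,
    fun z hz z' hz' => h.wDist_sq_le_quadGap
      (fun i => zero_le_one.trans (h.one_le_degPsi i)) hρ1 (fun i j => ?_) hN hz hz'⟩
  have := hle i j
  rwa [← mul_div_assoc, div_le_iff₀ (h.degD_pos j)] at this

theorem IsProblem.ap_rate (h : IsProblem F W β) (hN : 0 < N) (hR : 0 < R) {ε : ℝ} (hε : 0 < ε)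
    (hε2 : ε ≤ 1 / 2) (h0 : ε * wDist (degPsi F * W⁻¹) 0 (solutionSet F W a) ≤ 1) {k : ℕ}
    (hk : 500 * apBound F β * Real.log (1 / ε) ≤ k) :
    wDist (degPsi F * W⁻¹) (ap F W a k) (solutionSet F W a) ≤ ε := by
  obtain ⟨hB, herr⟩ := h.one_le_apBound (a := a) hN hR
  have hl := half_le_log_one_div hε hε2
  set d : ℕ → ℝ := fun k => wDist (degPsi F * W⁻¹) (ap F W a k) (solutionSet F W a) with hd
  have hmem : ∀ k, ap F W a k ∈ prodCone F := fun k => by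
    cases k with
    | zero => exact h.zero_mem_prodCone
    | succ k => exact h.apStep_mem _
  have hκ : 1 ≤ 36 * apBound F β := by linarith
  have hq : 0 ≤ 1 - 1 / (36 * apBound F β) :=
    sub_nonneg.2 ((div_le_one (by linarith)).2 hκ)
  have hrec : ∀ k, d k ^ 2 ≤ (1 - 1 / (36 * apBound F β)) ^ k * d 0 ^ 2 := fun k => by
    induction k with
    | zero => simp
    | succ k ih =>
      have h1 := h.wDist_sq_apStep_le (a := a) (by linarith) (hmem k) (herr _ (hmem k))
      have h2 := mul_le_mul_of_nonneg_left ih hq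
      rw [pow_succ' (1 - 1 / (36 * apBound F β)), mul_assoc]
      exact h1.trans h2
  have hpow : (1 - 1 / (36 * apBound F β)) ^ k ≤ ε ^ 4 := by
    refine one_sub_inv_pow_le hκ hε (le_trans ?_ hk)
    have : 0 ≤ apBound F β * Real.log (1 / ε) := by positivity
    push_cast
    linarith
  have hd0 : 0 ≤ d 0 := Real.sqrt_nonneg _
  have h2 : (ε * d 0) ^ 2 ≤ 1 := pow_le_one₀ (by positivity) h0
  refine le_of_sq_le_sq ?_ hε.le
  calc d k ^ 2 ≤ ε ^ 4 * d 0 ^ 2 :=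
        (hrec k).trans (mul_le_mul_of_nonneg_right hpow (sq_nonneg _))
    _ = ε ^ 2 * (ε * d 0) ^ 2 := by ring
    _ ≤ ε ^ 2 * 1 := by gcongr
    _ = ε ^ 2 := mul_one _

theorem IsProblem.rcd_rate {Ω : Type*} [MeasurableSpace Ω] {P : Measure Ω}
    [IsProbabilityMeasure P] {idx : ℕ → Ω → Fin R} (h : IsProblem F W β) (hN : 0 < N)
    (r₀ : Fin R) (hidx : ∀ k, Measurable (idx k)) (hind : iIndepFun idx P)
    (hunif : ∀ k r, P (idx k ⁻¹' {r}) = (R : ℝ≥0∞)⁻¹) {ε : ℝ} (hε : 0 < ε)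
    (hε2 : ε ≤ 1 / 2) (h0 : ε * potential F W a (0 : DualVar N R) ≤ 1) :
    ∫⁻ ω, hitTime W⁻¹ (solutionSet F W a) ε (rcd F W a fun k => idx k ω) ∂P
        ≤ ENNReal.ofReal (500 * rcdBound F β * Real.log (1 / ε)) ∧
      ∀ k : ℕ, 500 * rcdBound F β * Real.log (1 / ε) ≤ k →
        ∫⁻ ω, ENNReal.ofReal (wDist W⁻¹ (rcd F W a (fun j => idx j ω) k)
            (solutionSet F W a) ^ 2) ∂P ≤ ENNReal.ofReal (ε ^ 2) := by
  obtain ⟨κ, hκ, hκB, herr⟩ := h.exists_rcdBound_eq (a := a) hN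
  have hR : (1 : ℝ) ≤ R := by exact_mod_cast r₀.pos
  set B : ℝ := rcdBound F β with hB
  set l : ℝ := Real.log (1 / ε) with hl
  have hl2 : 1 / 2 ≤ l := half_le_log_one_div hε hε2
  have hκR : 1 ≤ 72 * B := by nlinarith
  have hB0 : 0 < B := by linarith
  have hB1 : 1 ≤ 36 * B := by nlinarith
  have hq : 0 ≤ 1 - 1 / (72 * B) := sub_nonneg.2 ((div_le_one (by linarith)).2 hκR)
  have hq1 : 1 - 1 / (72 * B) < 1 := by
    have : 0 < 1 / (72 * B) := by positivity
    linarith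
  have hpot0 : 0 ≤ potential F W a (0 : DualVar N R) := h.potential_nonneg h.zero_mem_prodCone
  have hexp : ∀ k, ∫⁻ ω, ENNReal.ofReal (wDist W⁻¹ (rcd F W a (fun j => idx j ω) k)
      (solutionSet F W a) ^ 2) ∂P ≤ ENNReal.ofReal ((1 - 1 / (72 * B)) ^ k *
        potential F W a (0 : DualVar N R)) := fun k => by
    rw [← hκB]
    exact (lintegral_mono fun ω => ENNReal.ofReal_le_ofReal
      (h.wDist_sq_le_potential (h.rcd_mem _ k))).trans
      (h.lintegral_potential_rcd_le r₀ hidx hind hunif hκ herr k)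
  have hsmall : ∀ k : ℕ, 216 * B * l ≤ k →
      (1 - 1 / (72 * B)) ^ k * potential F W a (0 : DualVar N R) ≤ ε ^ 2 := fun k hk => by
    have h1 : (1 - 1 / (72 * B)) ^ k ≤ ε ^ 3 :=
      one_sub_inv_pow_le hκR hε (le_trans (le_of_eq (by push_cast; ring)) hk)
    calc _ ≤ ε ^ 3 * potential F W a (0 : DualVar N R) := mul_le_mul_of_nonneg_right h1 hpot0
      _ = ε ^ 2 * (ε * potential F W a (0 : DualVar N R)) := by ring
      _ ≤ ε ^ 2 * 1 := by gcongr
      _ = ε ^ 2 := mul_one _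
  have hBl : 0 ≤ B * l := by positivity
  refine ⟨?_, fun k hk => (hexp k).trans
    (ENNReal.ofReal_le_ofReal (hsmall k (le_trans (by linarith) hk)))⟩
  set m : ℕ := ⌈216 * B * l⌉₊ with hm
  have hm1 : (m : ℝ) ≤ 216 * B * l + 1 := (Nat.ceil_lt_add_one (by positivity)).le
  have hm2 : 216 * B * l ≤ m := Nat.le_ceil _
  have hterm : ∀ j, ∫⁻ ω, ENNReal.ofReal ((ε ^ 2)⁻¹ *
      wDist W⁻¹ (rcd F W a (fun j => idx j ω) (m + j)) (solutionSet F W a) ^ 2) ∂P ≤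
      ENNReal.ofReal ((1 - 1 / (72 * B)) ^ j) := fun j => by
    have hε0 : 0 ≤ (ε ^ 2)⁻¹ := by positivity
    simp only [ENNReal.ofReal_mul hε0]
    rw [lintegral_const_mul _ (measurable_comp_rcd r₀ hidx (m + j)
      fun z => ENNReal.ofReal (wDist W⁻¹ z (solutionSet F W a) ^ 2))]
    refine (mul_le_mul_right (hexp (m + j)) _).trans ?_
    rw [← ENNReal.ofReal_mul hε0]
    refine ENNReal.ofReal_le_ofReal ?_
    have h1 := mul_le_mul_of_nonneg_left (hsmall m hm2) (pow_nonneg hq j)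
    calc _ = (ε ^ 2)⁻¹ * ((1 - 1 / (72 * B)) ^ j *
          ((1 - 1 / (72 * B)) ^ m * potential F W a (0 : DualVar N R))) := by
          rw [pow_add]; ring
      _ ≤ (ε ^ 2)⁻¹ * ((1 - 1 / (72 * B)) ^ j * ε ^ 2) := mul_le_mul_of_nonneg_left h1 hε0
      _ = _ := by field_simp
  calc _ ≤ ∫⁻ ω, ((m : ℝ≥0∞) + ∑' j, ENNReal.ofReal ((ε ^ 2)⁻¹ *
        wDist W⁻¹ (rcd F W a (fun j => idx j ω) (m + j)) (solutionSet F W a) ^ 2)) ∂P :=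
        lintegral_mono fun ω => hitTime_le _ _ hε _ m
    _ = m + ∑' j, ∫⁻ ω, ENNReal.ofReal ((ε ^ 2)⁻¹ *
        wDist W⁻¹ (rcd F W a (fun j => idx j ω) (m + j)) (solutionSet F W a) ^ 2) ∂P := by
        rw [lintegral_add_left measurable_const, lintegral_const, measure_univ, mul_one,
          lintegral_tsum fun j => (measurable_comp_rcd r₀ hidx (m + j) fun z =>
            ENNReal.ofReal ((ε ^ 2)⁻¹ * wDist W⁻¹ z (solutionSet F W a) ^ 2)).aemeasurable]
    _ ≤ m + ∑' j, ENNReal.ofReal ((1 - 1 / (72 * B)) ^ j) := by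
        gcongr with j
        exact hterm j
    _ = ENNReal.ofReal (m + 72 * B) := by
        rw [← ENNReal.ofReal_tsum_of_nonneg (fun j => pow_nonneg hq j)
          (summable_geometric_of_lt_one hq hq1), tsum_geometric_of_lt_one hq hq1,
          sub_sub_cancel, one_div, inv_inv, ENNReal.ofReal_add (by positivity) (by positivity),
          ENNReal.ofReal_natCast]
    _ ≤ ENNReal.ofReal (500 * B * l) := by
        refine ENNReal.ofReal_le_ofReal ?_
        -- `1 ≤ 36 B` and `1 / 2 ≤ l` absorb the additive terms
        have h1 : B * (1 / 2) ≤ B * l := mul_le_mul_of_nonneg_left hl2 hB0.le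
        linarith

end Rates

end QDSFM

theorem mainTheorem4 :
    ∃ C : ℝ, 0 < C ∧
      ∀ (N R : ℕ) (F : Fin R → Finset (Fin N) → ℝ) (W a : Fin N → ℝ) (β : ℝ),
        0 < N →
        (∀ r, QDSFM.IsSubmodular (F r)) →
        (∀ r, F r ∅ = 0) →
        (∀ r S, 0 ≤ F r S) →
        (∀ i, ∃ r, QDSFM.IsIncident (F r) i) →
        0 < β →
        (∀ i, W i = β * QDSFM.degD F i) →
        (QDSFM.solutionSet F W a).Nonempty ∧
        -- random coordinate descent
        (∀ (Ω : Type*) [MeasurableSpace Ω] (P : Measure Ω) [IsProbabilityMeasure P]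
            (idx : ℕ → Ω → Fin R),
          (∀ k, Measurable (idx k)) →
          iIndepFun idx P →
          (∀ k r, P (idx k ⁻¹' {r}) = (R : ℝ≥0∞)⁻¹) →
          ∀ ε : ℝ, 0 < ε → ε ≤ 1 / 2 →
            ε * (QDSFM.dualObj W a (0 : QDSFM.DualVar N R) - QDSFM.optValue F W a +
              QDSFM.wDist W⁻¹ 0 (QDSFM.solutionSet F W a) ^ 2) ≤ 1 →
            ∫⁻ ω, QDSFM.hitTime W⁻¹ (QDSFM.solutionSet F W a) ε
                (QDSFM.rcd F W a fun k => idx k ω) ∂P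
              ≤ ENNReal.ofReal (C * QDSFM.rcdBound F β * Real.log (1 / ε)) ∧
            ∀ k : ℕ, C * QDSFM.rcdBound F β * Real.log (1 / ε) ≤ k →
              ∫⁻ ω, ENNReal.ofReal (QDSFM.wDist W⁻¹ (QDSFM.rcd F W a (fun j => idx j ω) k)
                  (QDSFM.solutionSet F W a) ^ 2) ∂P
                ≤ ENNReal.ofReal (ε ^ 2)) ∧
        -- alternating projections
        (∀ ε : ℝ, 0 < ε → ε ≤ 1 / 2 →
          ε * QDSFM.wDist (QDSFM.degPsi F * W⁻¹) 0 (QDSFM.solutionSet F W a) ≤ 1 →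
          ∀ k : ℕ, C * QDSFM.apBound F β * Real.log (1 / ε) ≤ k →
            QDSFM.wDist (QDSFM.degPsi F * W⁻¹) (QDSFM.ap F W a k) (QDSFM.solutionSet F W a)
              ≤ ε) := by
  refine ⟨500, by norm_num, fun N R F W a β hN hsub hempty hnonneg hinc hβ hW => ?_⟩
  have h : QDSFM.IsProblem F W β := ⟨hsub, hempty, hnonneg, hinc, hβ, hW⟩
  obtain ⟨r₀, -⟩ := hinc ⟨0, hN⟩
  exact ⟨h.solutionSet_nonempty a,
    fun Ω _ P _ idx hidx hind hunif ε hε hε2 h0 =>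
      h.rcd_rate hN r₀ hidx hind hunif hε hε2 h0,
    fun ε hε hε2 h0 k hk => h.ap_rate hN r₀.pos hε hε2 h0 hk⟩
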